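/- Let $R$ be a positive division rig: a commutative semiring with $0\neq 1$ in which every nonzero element has a multiplicative inverse and in which $x+y=0$ implies $x=y=0$. A \emph{circuit} with $m$ inputs and $n$ outputs consists of a finite set of nodes (junctions), a finite multiset of undirected edges between nodes (parallel edges and loops are allowed), each of which is either a bare wire or a resistor with a conductance $y\in R$, $y\neq 0$, and an assignment of a node to each of the $m$ inputs and each of the $n$ outputs. A node is \emph{internal} if no input or output is assigned to it. Circuits are taken up to renaming of nodes. Two circuits are composed by joining the outputs of the first to the inputs of the second by wires, and tensored by juxtaposition. Let $\mathsf{Resist}_R$ be the category whose objects are the natural numbers and whose maps $m\to n$ are the circuits with $m$ inputs and $n$ outputs, modulo the congruence (for composition and tensor product) generated by the identity laws, the spider identities (two junctions joined by a wire are amalgamated; a wire from a junction to itself is removed), self-adjointness of resistors, and the following identities: a resistor in parallel with a wire equals the wire; two parallel resistors $y,z$ equal one resistor $y+z$; for every $n\ge 0$, the star with an internal centre and arms of conductances $y_1,\dots,y_n$ to $n$ outer nodes equals the mesh on the $n$ outer nodes with conductance $y_iy_j/\sum_k y_k$ between the nodes $i\neq j$. Consider the following rewriting steps, applied anywhere in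 a circuit: \begin{itemize} \item Spider: amalgamate two different nodes joined by a wire, deleting that wire; delete a wire from a node to itself. \item Short circuit: delete a resistor that is parallel to a wire or that joins a node to itself. \item Parallel: replace two resistors $y,z$ with the same ends by one resistor $y+z$. \item $(Y/\Delta)_k$, $k\ge 0$: if $x$ is an internal node whose edges are exactly $k$ resistors $y_1,\dots,y_k$ to nodes $a_1,\dots,a_k\neq x$ (not necessarily distinct), delete $x$ and these resistors and add, for all $i<j$, a resistor $y_iy_j/\sum_l y_l$ between $a_i$ and $a_j$. \end{itemize} Let $N$ be the number of nodes of a circuit, and $P$ the number of its parallel edges, that is, of edges that are loops or have the same ends as another edge. Then, for circuits with $m$ inputs and $n$ outputs: \begin{enumerate} \item every rewriting step strictly decreases $(N,P)$ in the lexicographic order, and the rewriting system terminates; \item it is locally confluent, and it is confluent; \item a circuit is in normal form (admits no step) if and only if it is a family of meshes, that is, it has no internal node, no bare wire and no loop, and any two nodes are joined by at most one resistor; \item every circuit rewrites to exactly one normal form; \item two circuits present the same map of $\mathsf{Resist}_R$ if and only if they rewrite to a common circuit. \end{enumerate} -/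

import Mathlib

universe u

/-! ## Positive division rigs

A commutative division rig is a `Semifield`.  It is positive if a sum vanishes only when both
summands do. -/

class PositiveRig (R : Type u) [AddCommMonoid R] : Prop where
  eq_zero_of_add_eq_zero : ∀ x y : R, x + y = 0 → x = 0 ∧ y = 0

/-- The conductances: nonzero elements of the rig. -/
abbrev Conductance (R : Type u) [Semifield R] : Type u := {y : R // y ≠ 0}

namespace Conductance

variable {R : Type u} [Semifield R] [PositiveRig R]

/-- The conductance of two resistors in parallel. -/
def add (y z : Conductance R) : Conductance R :=
  ⟨y.1 + z.1, fun h => y.2 (PositiveRig.eq_zero_of_add_eq_zero _ _ h).1⟩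

theorem sum_ne_zero {n : ℕ} (y : Fin n → Conductance R) (i : Fin n) :
    ∑ k, (y k).1 ≠ 0 := by
  intro h
  rw [← Finset.add_sum_erase _ _ (Finset.mem_univ i)] at h
  exact (y i).2 (PositiveRig.eq_zero_of_add_eq_zero _ _ h).1

/-- The conductance `y i * y j / ∑ k, y k` between the nodes `i` and `j` of the mesh that
corresponds to the star with arms `y`. -/
def mesh {n : ℕ} (y : Fin n → Conductance R) (i j : Fin n) : Conductance R :=
  ⟨(y i).1 * (y j).1 / ∑ k, (y k).1,
    div_ne_zero (mul_ne_zero (y i).2 (y j).2) (sum_ne_zero y i)⟩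

end Conductance

/-! ## Circuits -/

/-- What an edge of a circuit consists of: a bare wire, or a resistor of given conductance. -/
inductive Link (R : Type u) [Semifield R] : Type u where
  | wire : Link R
  | resistor (y : Conductance R) : Link R

/-- An (undirected) edge on the node set `V`; parallel edges and loops are possible in a
circuit.  Resistors are undirected since they are self-adjoint. -/
abbrev Edge (R : Type u) [Semifield R] (V : Type) : Type u := Sym2 V × Link R

namespace Edge

variable {R : Type u} [Semifield R] {V W : Type}

def map (f : V → W) (e : Edge R V) : Edge R W := (Sym2.map f e.1, e.2)

/-- A bare wire between `a` and `b`. -/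
def wire (a b : V) : Edge R V := (s(a, b), Link.wire)

/-- A resistor between `a` and `b`. -/
def resistor (a b : V) (y : Conductance R) : Edge R V := (s(a, b), Link.resistor y)

theorem map_map {U : Type} (g : V → W) (f : U → V) (e : Edge R U) :
    map g (map f e) = map (g ∘ f) e := by
  simp [map, Sym2.map_map]

theorem map_id' (e : Edge R V) : map id e = e := by simp [map]

theorem map_wire (f : V → W) (a b : V) : map f (wire a b : Edge R V) = wire (f a) (f b) := by
  simp [map, wire]

end Edge

/-- A string diagram with `m` inputs and `n` outputs built from junctions (spiders) and
conductances, in fully expanded form: there is a junction at both ends of every wire and of every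
resistor, and every input and every output is a leg of a junction.  The nodes are the junctions,
the edges are the bare wires and the resistors between them. -/
structure Circuit (R : Type u) [Semifield R] (m n : ℕ) where
  Node : Type
  finite_node : Finite Node
  edges : Multiset (Edge R Node)
  inp : Fin m → Node
  out : Fin n → Node

namespace Circuit

variable {R : Type u} [Semifield R] {m n k : ℕ}

/-- Isomorphism of circuits: a renaming of the nodes. -/
def Iso (C D : Circuit R m n) : Prop :=
  ∃ e : C.Node ≃ D.Node, C.edges.map (Edge.map e) = D.edges ∧
    (∀ i, e (C.inp i) = D.inp i) ∧ (∀ j, e (C.out j) = D.out j)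

theorem Iso.refl (C : Circuit R m n) : Iso C C :=
  ⟨Equiv.refl _, (Multiset.map_congr rfl fun x _ => Edge.map_id' x).trans (Multiset.map_id _),
    fun _ => rfl, fun _ => rfl⟩

theorem Iso.symm {C D : Circuit R m n} : Iso C D → Iso D C := by
  rintro ⟨e, he, hi, ho⟩
  refine ⟨e.symm, ?_, fun i => by simp [← hi], fun j => by simp [← ho]⟩
  rw [← he, Multiset.map_map]
  simp [Function.comp_def, Edge.map, Sym2.map_map]

theorem Iso.trans {C D E : Circuit R m n} : Iso C D → Iso D E → Iso C E := by
  rintro ⟨e, he, hi, ho⟩ ⟨f, hf, hi', ho'⟩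
  refine ⟨e.trans f, ?_, fun i => by simp [hi, hi'], fun j => by simp [ho, ho']⟩
  rw [← hf, ← he, Multiset.map_map]
  refine Multiset.map_congr rfl fun x _ => ?_
  simp [Edge.map, Sym2.map_map]

instance setoid (R : Type u) [Semifield R] (m n : ℕ) : Setoid (Circuit R m n) :=
  ⟨Iso, Iso.refl, Iso.symm, Iso.trans⟩

/-- The identity: `n` junctions, each with one input and one output. -/
def id (R : Type u) [Semifield R] (n : ℕ) : Circuit R n n :=
  ⟨Fin n, inferInstance, 0, fun i => i, fun i => i⟩

/-- The junction with `m` inputs and `n` outputs. -/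
def junction (R : Type u) [Semifield R] (m n : ℕ) : Circuit R m n :=
  ⟨Unit, inferInstance, 0, fun _ => (), fun _ => ()⟩

/-- A resistor, as a circuit from `1` to `1`. -/
def conductance (y : Conductance R) : Circuit R 1 1 :=
  ⟨Bool, inferInstance, {Edge.resistor false true y}, fun _ => false, fun _ => true⟩

/-- Composition in diagrammatic order: the outputs of `C` are wired to the inputs of `D`. -/
def comp (C : Circuit R m k) (D : Circuit R k n) : Circuit R m n where
  Node := C.Node ⊕ D.Node
  finite_node := by
    have := C.finite_node
    have := D.finite_node
    infer_instance
  edges := C.edges.map (Edge.map Sum.inl) + D.edges.map (Edge.map Sum.inr) +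
    (Finset.univ : Finset (Fin k)).val.map
      fun j => Edge.wire (Sum.inl (C.out j)) (Sum.inr (D.inp j))
  inp := fun i => Sum.inl (C.inp i)
  out := fun j => Sum.inr (D.out j)

/-- The tensor product: juxtaposition. -/
def tensor {m' n' : ℕ} (C : Circuit R m n) (D : Circuit R m' n') :
    Circuit R (m + m') (n + n') where
  Node := C.Node ⊕ D.Node
  finite_node := by
    have := C.finite_node
    have := D.finite_node
    infer_instance
  edges := C.edges.map (Edge.map Sum.inl) + D.edges.map (Edge.map Sum.inr)
  inp := Fin.append (fun i => Sum.inl (C.inp i)) (fun i => Sum.inr (D.inp i))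
  out := Fin.append (fun j => Sum.inl (C.out j)) (fun j => Sum.inr (D.out j))

/-- The star with one internal node `none`, and arms of conductances `y i` to the `n` nodes
`some i`, the `i`-th of which is the `i`-th output. -/
def star {n : ℕ} (y : Fin n → Conductance R) : Circuit R 0 n :=
  ⟨Option (Fin n), inferInstance,
    (Finset.univ : Finset (Fin n)).val.map fun i => Edge.resistor none (some i) (y i),
    fun i => i.elim0, fun i => some i⟩

/-- The edges of the mesh which replaces a star whose `i`-th arm has conductance `y i` and ends at
the node `a i`: one resistor for each pair of arms `i < j`. -/
def meshEdges [PositiveRig R] {V : Type} {n : ℕ} (a : Fin n → V) (y : Fin n → Conductance R) :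
    Multiset (Edge R V) :=
  ((Finset.univ : Finset (Fin n × Fin n)).filter fun p => p.1 < p.2).val.map
    fun p => Edge.resistor (a p.1) (a p.2) (Conductance.mesh y p.1 p.2)

/-- The mesh corresponding to the star with arms `y`: all `n` nodes are outputs. -/
def mesh [PositiveRig R] {n : ℕ} (y : Fin n → Conductance R) : Circuit R 0 n :=
  ⟨Fin n, inferInstance, meshEdges (fun i => i) y, fun i => i.elim0, fun i => i⟩

/-- The number of nodes. -/
noncomputable def numNodes (C : Circuit R m n) : ℕ := Nat.card C.Node

open Classical in
/-- The number of parallel edges: an edge is counted if another edge has the same ends, or if it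
is a loop (so that it is parallel to the junction itself). -/
noncomputable def numParallel (C : Circuit R m n) : ℕ :=
  (C.edges.filter fun e => e.1.IsDiag ∨ 2 ≤ (C.edges.map Prod.fst).count e.1).card

/-- A node is external if an input or an output is attached to it, and internal otherwise. -/
def IsExternal (C : Circuit R m n) (v : C.Node) : Prop :=
  (∃ i, C.inp i = v) ∨ (∃ j, C.out j = v)

/-- Families of meshes: all nodes are external (each carries one or more inputs or outputs), there
are no bare wires and no loops, and any two nodes are joined by at most one resistor. -/
def IsMeshFamily (C : Circuit R m n) : Prop :=
  (∀ v, C.IsExternal v) ∧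
  (∀ e ∈ C.edges, (∃ y, e.2 = Link.resistor y) ∧ ¬ e.1.IsDiag) ∧
  (C.edges.map Prod.fst).Nodup

/-- The spider rewrites, at any place of a circuit. -/
inductive SpiderRule : Circuit R m n → Circuit R m n → Prop where
  /-- Two different junctions `none` and `some u` which are joined by a wire are amalgamated. -/
  | fuse (V : Type) (hV : Finite V) (u : V) (rest : Multiset (Edge R (Option V)))
      (inp : Fin m → Option V) (out : Fin n → Option V) :
      SpiderRule
        ⟨Option V, inferInstance, Edge.wire none (some u) ::ₘ rest, inp, out⟩
        ⟨V, hV, rest.map (Edge.map fun v => v.getD u),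
          fun i => (inp i).getD u, fun j => (out j).getD u⟩
  /-- A wire from a junction to itself is removed. -/
  | loop (V : Type) (hV : Finite V) (u : V) (rest : Multiset (Edge R V))
      (inp : Fin m → V) (out : Fin n → V) :
      SpiderRule ⟨V, hV, Edge.wire u u ::ₘ rest, inp, out⟩ ⟨V, hV, rest, inp, out⟩

/-- The rewrites of resistors, at any place of a circuit. -/
inductive ResistorRule [PositiveRig R] : Circuit R m n → Circuit R m n → Prop where
  /-- A resistor in parallel with a wire is removed. -/
  | shortCircuit (V : Type) (hV : Finite V) (u v : V) (y : Conductance R)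
      (rest : Multiset (Edge R V)) (inp : Fin m → V) (out : Fin n → V) :
      ResistorRule
        ⟨V, hV, Edge.resistor u v y ::ₘ Edge.wire u v ::ₘ rest, inp, out⟩
        ⟨V, hV, Edge.wire u v ::ₘ rest, inp, out⟩
  /-- The same when the wire has already been absorbed in a junction: a resistor from a junction
  to itself is removed. -/
  | shortCircuitLoop (V : Type) (hV : Finite V) (u : V) (y : Conductance R)
      (rest : Multiset (Edge R V)) (inp : Fin m → V) (out : Fin n → V) :
      ResistorRule
        ⟨V, hV, Edge.resistor u u y ::ₘ rest, inp, out⟩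
        ⟨V, hV, rest, inp, out⟩
  /-- Two parallel resistors are combined. -/
  | parallel (V : Type) (hV : Finite V) (u v : V) (y z : Conductance R)
      (rest : Multiset (Edge R V)) (inp : Fin m → V) (out : Fin n → V) :
      ResistorRule
        ⟨V, hV, Edge.resistor u v y ::ₘ Edge.resistor u v z ::ₘ rest, inp, out⟩
        ⟨V, hV, Edge.resistor u v (y.add z) ::ₘ rest, inp, out⟩
  /-- The star-to-mesh rule with `k` arms, for every `k`: the internal node `none`, all of whose
  edges are resistors to other nodes `a i` (which need not be different), is eliminated. -/
  | starMesh (V : Type) (hV : Finite V) (k : ℕ) (a : Fin k → V) (y : Fin k → Conductance R)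
      (rest : Multiset (Edge R V)) (inp : Fin m → V) (out : Fin n → V) :
      ResistorRule
        ⟨Option V, inferInstance,
          (Finset.univ : Finset (Fin k)).val.map
            (fun i => Edge.resistor none (some (a i)) (y i)) + rest.map (Edge.map some),
          fun i => some (inp i), fun j => some (out j)⟩
        ⟨V, hV, meshEdges a y + rest, inp, out⟩

theorem Iso.comp {C C' : Circuit R m k} {D D' : Circuit R k n} (h : Iso C C') (h' : Iso D D') :
    Iso (C.comp D) (C'.comp D') := by
  obtain ⟨e, he, hi, ho⟩ := h
  obtain ⟨f, hf, hi', ho'⟩ := h'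
  refine ⟨Equiv.sumCongr e f, ?_, fun i => congrArg Sum.inl (hi i),
    fun j => congrArg Sum.inr (ho' j)⟩
  simp only [Circuit.comp, Multiset.map_add, Multiset.map_map, ← he, ← hf]
  congr 1
  · congr 1 <;>
    · refine Multiset.map_congr rfl fun x _ => ?_
      simp only [Function.comp_apply, Edge.map_map]
      rfl
  · refine Multiset.map_congr rfl fun x _ => ?_
    simp only [Function.comp_apply, Edge.map_wire, ← ho, ← hi']
    rfl

theorem Iso.tensor {m' n' : ℕ} {C C' : Circuit R m n} {D D' : Circuit R m' n'} (h : Iso C C')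
    (h' : Iso D D') : Iso (C.tensor D) (C'.tensor D') := by
  obtain ⟨e, he, hi, ho⟩ := h
  obtain ⟨f, hf, hi', ho'⟩ := h'
  refine ⟨Equiv.sumCongr e f, ?_, fun i => ?_, fun j => ?_⟩
  · simp only [Circuit.tensor, Multiset.map_add, Multiset.map_map, ← he, ← hf]
    congr 1 <;>
    · refine Multiset.map_congr rfl fun x _ => ?_
      simp only [Function.comp_apply, Edge.map_map]
      rfl
  · refine Fin.addCases (fun i => ?_) (fun i => ?_) i
    · simp only [Circuit.tensor, Fin.append_left]
      exact congrArg Sum.inl (hi i)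
    · simp only [Circuit.tensor, Fin.append_right]
      exact congrArg Sum.inr (hi' i)
  · refine Fin.addCases (fun j => ?_) (fun j => ?_) j
    · simp only [Circuit.tensor, Fin.append_left]
      exact congrArg Sum.inl (ho j)
    · simp only [Circuit.tensor, Fin.append_right]
      exact congrArg Sum.inr (ho' j)

theorem comp_assoc_iso {l : ℕ} (C : Circuit R m k) (D : Circuit R k l) (E : Circuit R l n) :
    Iso ((C.comp D).comp E) (C.comp (D.comp E)) := by
  refine ⟨Equiv.sumAssoc C.Node D.Node E.Node, ?_, fun i => rfl, fun j => rfl⟩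
  simp only [Circuit.comp, Multiset.map_add, Multiset.map_map, Function.comp_def, Edge.map_map,
    Edge.map_wire]
  have h : ∀ a b c d e : Multiset (Edge R (C.Node ⊕ D.Node ⊕ E.Node)),
      a + b + c + d + e = a + (b + d + e) + c := fun a b c d e => by abel
  exact h _ _ _ _ _

theorem Iso.numNodes_eq {C D : Circuit R m n} (h : Iso C D) : C.numNodes = D.numNodes := by
  obtain ⟨e, -⟩ := h
  exact Nat.card_congr e

theorem Iso.numParallel_eq {C D : Circuit R m n} (h : Iso C D) :
    C.numParallel = D.numParallel := by
  classical
  obtain ⟨e, he, -, -⟩ := h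
  unfold numParallel
  rw [← he, Multiset.filter_map, Multiset.card_map]
  congr 1
  refine Multiset.filter_congr fun x _ => ?_
  have h1 : ((C.edges.map (Edge.map e)).map Prod.fst) =
      (C.edges.map Prod.fst).map (Sym2.map e) := by
    rw [Multiset.map_map, Multiset.map_map]
    rfl
  have hinj : Function.Injective (Sym2.map e) := Sym2.map.injective e.injective
  have h2 : (Edge.map e x).1.IsDiag ↔ x.1.IsDiag := by
    obtain ⟨p, l⟩ := x
    induction p using Sym2.ind with
    | _ a b => simp [Edge.map]
  simp only [Function.comp_apply, h1, h2]
  show _ ↔ (_ ∨ 2 ≤ Multiset.count (Sym2.map e x.1) _)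
  rw [Multiset.count_map_eq_count' _ _ hinj]

end Circuit

/-! ## Diagrams: circuits up to the names of their nodes -/

/-- Circuits up to isomorphism; this is what is rewritten. -/
def Diagram (R : Type u) [Semifield R] (m n : ℕ) : Type (max 1 u) :=
  Quotient (Circuit.setoid R m n)

namespace Diagram

variable {R : Type u} [Semifield R] {m n k : ℕ}

def mk (C : Circuit R m n) : Diagram R m n := Quotient.mk _ C

def id (R : Type u) [Semifield R] (n : ℕ) : Diagram R n n := mk (Circuit.id R n)

def junction (R : Type u) [Semifield R] (m n : ℕ) : Diagram R m n := mk (Circuit.junction R m n)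

def conductance (y : Conductance R) : Diagram R 1 1 := mk (Circuit.conductance y)

def comp (c : Diagram R m k) (d : Diagram R k n) : Diagram R m n :=
  Quotient.map₂ Circuit.comp (fun _ _ h _ _ h' => Circuit.Iso.comp h h') c d

def tensor {m' n' : ℕ} (c : Diagram R m n) (d : Diagram R m' n') :
    Diagram R (m + m') (n + n') :=
  Quotient.map₂ Circuit.tensor (fun _ _ h _ _ h' => Circuit.Iso.tensor h h') c d

noncomputable def numNodes (d : Diagram R m n) : ℕ :=
  Quotient.lift Circuit.numNodes (fun _ _ h => Circuit.Iso.numNodes_eq h) d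

noncomputable def numParallel (d : Diagram R m n) : ℕ :=
  Quotient.lift Circuit.numParallel (fun _ _ h => Circuit.Iso.numParallel_eq h) d

def IsMeshFamily (d : Diagram R m n) : Prop := ∃ C : Circuit R m n, d = mk C ∧ C.IsMeshFamily

/-- One rewriting step. -/
def Step [PositiveRig R] (c d : Diagram R m n) : Prop :=
  ∃ C D : Circuit R m n, c = mk C ∧ d = mk D ∧ (C.SpiderRule D ∨ C.ResistorRule D)

theorem comp_assoc {l : ℕ} (c : Diagram R m k) (d : Diagram R k l) (e : Diagram R l n) :
    (c.comp d).comp e = c.comp (d.comp e) := by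
  induction c using Quotient.inductionOn with
  | _ C =>
    induction d using Quotient.inductionOn with
    | _ D =>
      induction e using Quotient.inductionOn with
      | _ E => exact Quotient.sound (Circuit.comp_assoc_iso C D E)

/-- Equality of the maps presented by two diagrams: the congruence for composition and tensor
product generated by the identity laws, the spider identities, and the identities for
resistors. -/
inductive Equal [PositiveRig R] : ∀ {m n : ℕ}, Diagram R m n → Diagram R m n → Prop where
  | refl {m n : ℕ} (c : Diagram R m n) : Equal c c
  | symm {m n : ℕ} {c d : Diagram R m n} : Equal c d → Equal d c
  | trans {m n : ℕ} {c d e : Diagram R m n} : Equal c d → Equal d e → Equal c e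
  | comp_congr {m k n : ℕ} {c c' : Diagram R m k} {d d' : Diagram R k n} :
      Equal c c' → Equal d d' → Equal (c.comp d) (c'.comp d')
  | tensor_congr {m n m' n' : ℕ} {c c' : Diagram R m n} {d d' : Diagram R m' n'} :
      Equal c c' → Equal d d' → Equal (c.tensor d) (c'.tensor d')
  | id_comp {m n : ℕ} (c : Diagram R m n) : Equal ((id R m).comp c) c
  | comp_id {m n : ℕ} (c : Diagram R m n) : Equal (c.comp (id R n)) c
  | spider {m n : ℕ} {C D : Circuit R m n} : C.SpiderRule D → Equal (mk C) (mk D)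
  /-- A resistor equals its transpose. -/
  | selfAdjoint (y : Conductance R) :
      Equal (m := 1) (n := 1)
        (((id R 1).tensor (junction R 0 2)).comp
          ((((id R 1).tensor (conductance y)).tensor (id R 1)).comp
            ((junction R 2 0).tensor (id R 1))))
        (conductance y)
  | shortCircuit (y : Conductance R) :
      Equal ((junction R 1 2).comp (((conductance y).tensor (id R 1)).comp (junction R 2 1)))
        (id R 1)
  | parallel (y z : Conductance R) :
      Equal ((junction R 1 2).comp (((conductance y).tensor (conductance z)).comp
        (junction R 2 1))) (conductance (y.add z))
  | starMesh {n : ℕ} (y : Fin n → Conductance R) :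
      Equal (mk (Circuit.star y)) (mk (Circuit.mesh y))

end Diagram

/-! ## The category of resistor circuits -/

/-- The objects of the category of resistor circuits: natural numbers. -/
structure Resist (R : Type u) : Type where
  arity : ℕ

namespace Resist

variable {R : Type u} [Semifield R] [PositiveRig R]

def setoid (R : Type u) [Semifield R] [PositiveRig R] (m n : ℕ) : Setoid (Diagram R m n) :=
  ⟨Diagram.Equal, Diagram.Equal.refl, Diagram.Equal.symm, Diagram.Equal.trans⟩

instance category : CategoryTheory.Category.{max 1 u} (Resist R) where
  Hom X Y := Quotient (setoid R X.arity Y.arity)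
  id X := Quotient.mk _ (Diagram.id R X.arity)
  comp f g := Quotient.map₂ Diagram.comp (fun _ _ h _ _ h' => Diagram.Equal.comp_congr h h') f g
  id_comp f := by
    induction f using Quotient.inductionOn with
    | _ c => exact Quotient.sound (Diagram.Equal.id_comp c)
  comp_id f := by
    induction f using Quotient.inductionOn with
    | _ c => exact Quotient.sound (Diagram.Equal.comp_id c)
  assoc f g h := by
    induction f using Quotient.inductionOn with
    | _ c =>
      induction g using Quotient.inductionOn with
      | _ d =>
        induction h using Quotient.inductionOn with
        | _ e => exact congrArg (Quotient.mk _) (Diagram.comp_assoc c d e)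

/-- The map presented by a diagram. -/
def ofDiagram {m n : ℕ} (d : Diagram R m n) : (Resist.mk m : Resist R) ⟶ Resist.mk n :=
  Quotient.mk (setoid R m n) d

/-- The tensor product of maps; on objects it is addition. -/
def tensorHom {X Y X' Y' : Resist R} (f : X ⟶ Y) (g : X' ⟶ Y') :
    (Resist.mk (X.arity + X'.arity) : Resist R) ⟶ Resist.mk (Y.arity + Y'.arity) :=
  Quotient.map₂ (sa := setoid R X.arity Y.arity) (sb := setoid R X'.arity Y'.arity)
    (sc := setoid R (X.arity + X'.arity) (Y.arity + Y'.arity)) Diagram.tensor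
    (fun _ _ h _ _ h' => Diagram.Equal.tensor_congr h h') f g

end Resist

/-! ## Abstract rewriting -/

namespace Rewriting

variable {α : Type u}

def Terminating (r : α → α → Prop) : Prop := WellFounded fun b a => r a b

def LocallyConfluent (r : α → α → Prop) : Prop :=
  ∀ a b c, r a b → r a c → Relation.Join (Relation.ReflTransGen r) b c

def Confluent (r : α → α → Prop) : Prop :=
  ∀ a b c, Relation.ReflTransGen r a b → Relation.ReflTransGen r a c →
    Relation.Join (Relation.ReflTransGen r) b c

def IsNormal (r : α → α → Prop) (a : α) : Prop := ∀ b, ¬ r a b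

end Rewriting

/-!
Contracting the wires of a circuit, adding up parallel conductances and eliminating the internal
nodes by star-mesh transformations yields a set of points, with the inputs and outputs on them, and
a conductance between any two of them. The order of the eliminations is irrelevant: in a positive
rig no sum of conductances vanishes, and eliminating two nodes one after the other is symmetric in
them. This response is the same before and after every rewriting step, and it determines a family
of meshes up to renaming. As normal forms are families of meshes and the system terminates, it is
confluent; no critical pairs have to be resolved.

The generating identities of the category, applied to whole circuits, are rewritings, and
rewriting is compatible with composition and tensor product, so equal maps are joinable. For the
converse, a circuit to which a rule applies is, up to contracting wires, a composite of the
left-hand side of a generating identity with its surroundings, so a rewriting step is an equality.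
-/

open Relation (ReflTransGen Join)

namespace Rewriting

variable {α : Type u} {r : α → α → Prop}

theorem Terminating.exists_isNormal (ht : Terminating r) (a : α) :
    ∃ b, ReflTransGen r a b ∧ IsNormal r b := by
  induction a using ht.induction with
  | _ a ih =>
    by_cases ha : IsNormal r a
    · exact ⟨a, .refl, ha⟩
    · obtain ⟨b, hab⟩ : ∃ b, r a b := by simpa [IsNormal] using ha
      obtain ⟨c, hbc, hc⟩ := ih b hab
      exact ⟨c, .head hab hbc, hc⟩

theorem IsNormal.eq_of_reflTransGen {a b : α} (ha : IsNormal r a) (h : ReflTransGen r a b) :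
    a = b :=
  h.cases_head.resolve_right fun ⟨c, hac, _⟩ => ha c hac

theorem apply_eq_of_reflTransGen {β : Type*} {f : α → β} (hf : ∀ a b, r a b → f a = f b) {a b : α}
    (h : ReflTransGen r a b) : f a = f b := by
  induction h with
  | refl => rfl
  | tail _ hbc ih => exact ih.trans (hf _ _ hbc)

theorem Terminating.confluent_of_invariant {β : Type*} (ht : Terminating r) {f : α → β}
    (hf : ∀ a b, r a b → f a = f b) (hinj : {a | IsNormal r a}.InjOn f) : Confluent r := by
  intro a b c hab hac
  obtain ⟨b', hb, hb'⟩ := ht.exists_isNormal b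
  obtain ⟨c', hc, hc'⟩ := ht.exists_isNormal c
  have hbc : b' = c' := hinj hb' hc' <|
    (apply_eq_of_reflTransGen hf (hab.trans hb)).symm.trans
      (apply_eq_of_reflTransGen hf (hac.trans hc))
  exact ⟨b', hb, hbc ▸ hc⟩

theorem Confluent.locallyConfluent (hc : Confluent r) : LocallyConfluent r :=
  fun a b c hab hac => hc a b c (.single hab) (.single hac)

theorem Confluent.existsUnique_isNormal (hc : Confluent r) (ht : Terminating r) (a : α) :
    ∃! b, ReflTransGen r a b ∧ IsNormal r b := by
  obtain ⟨b, hab, hb⟩ := ht.exists_isNormal a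
  refine ⟨b, ⟨hab, hb⟩, fun b' ⟨hab', hb'⟩ => ?_⟩
  obtain ⟨c, hbc, hbc'⟩ := hc a b b' hab hab'
  exact (hb'.eq_of_reflTransGen hbc').trans (hb.eq_of_reflTransGen hbc).symm

end Rewriting

theorem exists_equiv_of_surjective {α β γ : Type*} {f : α → β} {g : α → γ}
    (hf : Function.Surjective f) (hg : Function.Surjective g)
    (h : ∀ x y, f x = f y ↔ g x = g y) : ∃ e : β ≃ γ, ∀ x, e (f x) = g x := by
  have hker : Setoid.ker f = Setoid.ker g := Setoid.ext h
  refine ⟨(Setoid.quotientKerEquivOfSurjective f hf).symm.trans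
    ((Quotient.congrRight fun x y => by rw [hker]).trans
      (Setoid.quotientKerEquivOfSurjective g hg)), fun x => ?_⟩
  have hx : (Setoid.quotientKerEquivOfSurjective f hf).symm (f x) = Quotient.mk (Setoid.ker f) x :=
    (Equiv.symm_apply_eq _).2 rfl
  rw [Equiv.trans_apply, hx]
  rfl

/-- The map `π` is a quotient map for the equivalence relation generated by `r`, that is, it
agrees with the projection to `Quot r` up to a bijection. -/
structure IsQuotientBy {V Q : Type*} (r : V → V → Prop) (π : V → Q) : Prop where
  surjective : Function.Surjective π
  eq_iff : ∀ {x y}, π x = π y ↔ Quot.mk r x = Quot.mk r y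

namespace IsQuotientBy

variable {V W Q Q' : Type*} {r : V → V → Prop} {s : W → W → Prop}

theorem quotMk (r : V → V → Prop) : IsQuotientBy r (Quot.mk r) := ⟨Quot.mk_surjective, Iff.rfl⟩

theorem eq_of_rel {π : V → Q} (hπ : IsQuotientBy r π) {x y : V} (h : r x y) : π x = π y :=
  hπ.eq_iff.2 (Quot.sound h)

theorem exists_equiv {π : V → Q} {π' : V → Q'} (hπ : IsQuotientBy r π)
    (hπ' : IsQuotientBy r π') : ∃ e : Q ≃ Q', ∀ x, e (π x) = π' x :=
  exists_equiv_of_surjective hπ.surjective hπ'.surjective fun _ _ =>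
    hπ.eq_iff.trans hπ'.eq_iff.symm

theorem of_section {π : V → Q} (g : Q → V) (hg : ∀ q, π (g q) = q)
    (hr : ∀ x y, r x y → π x = π y) (hgπ : ∀ x, Quot.mk r (g (π x)) = Quot.mk r x) :
    IsQuotientBy r π where
  surjective q := ⟨g q, hg q⟩
  eq_iff {x y} := by
    refine ⟨fun h => ?_, fun h => congrArg (Quot.lift π hr) h⟩
    rw [← hgπ x, h, hgπ y]

theorem comp {π : W → Q} (hπ : IsQuotientBy s π) (f : V → W) (g : W → V)
    (hf : ∀ x y, r x y → Quot.mk s (f x) = Quot.mk s (f y))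
    (hg : ∀ x y, s x y → Quot.mk r (g x) = Quot.mk r (g y))
    (hgf : ∀ x, Quot.mk r (g (f x)) = Quot.mk r x)
    (hfg : ∀ y, Quot.mk s (f (g y)) = Quot.mk s y) : IsQuotientBy r (π ∘ f) where
  surjective q := by
    obtain ⟨y, rfl⟩ := hπ.surjective q
    exact ⟨g y, hπ.eq_iff.2 (hfg y)⟩
  eq_iff {x y} := by
    refine hπ.eq_iff.trans ⟨fun h => ?_, fun h => congrArg (Quot.lift (Quot.mk s ∘ f) hf) h⟩
    rw [← hgf x, ← hgf y]
    exact congrArg (Quot.lift (Quot.mk r ∘ g) hg) h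

theorem congr {r' : V → V → Prop} {π : V → Q} (hπ : IsQuotientBy r π)
    (h : ∀ x y, r' x y → Quot.mk r x = Quot.mk r y)
    (h' : ∀ x y, r x y → Quot.mk r' x = Quot.mk r' y) : IsQuotientBy r' π :=
  hπ.comp id id h h' (fun _ => rfl) fun _ => rfl

end IsQuotientBy

namespace Edge

variable {R : Type u} [Semifield R] {U V W : Type}

theorem map_resistor (f : V → W) (a b : V) (y : Conductance R) :
    map f (resistor a b y) = resistor (f a) (f b) y := rfl

theorem wire_comm (a b : V) : (wire a b : Edge R V) = wire b a := by
  rw [wire, wire, Sym2.eq_swap]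

theorem resistor_comm (a b : V) (y : Conductance R) : resistor a b y = resistor b a y := by
  rw [resistor, resistor, Sym2.eq_swap]

theorem map_multiset_id (E : Multiset (Edge R V)) : E.map (map id) = E := by
  simp only [map_id', Multiset.map_id']

theorem map_multiset_map (f : V → W) (g : U → V) (E : Multiset (Edge R U)) :
    (E.map (map g)).map (map f) = E.map (map (f ∘ g)) := by
  simp only [Multiset.map_map, Function.comp_def, map_map]

end Edge

namespace Diagram

variable {R : Type u} [Semifield R] {m n : ℕ}

theorem mk_eq_mk_iff {C D : Circuit R m n} : mk C = mk D ↔ C.Iso D :=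
  ⟨fun h => Quotient.exact h, fun h => Quotient.sound h⟩

/-- A rewriting step by a spider rule. -/
def SpiderStep (c d : Diagram R m n) : Prop :=
  ∃ C D : Circuit R m n, c = mk C ∧ d = mk D ∧ C.SpiderRule D

theorem mk_rename {V W : Type} (hV : Finite V) (hW : Finite W) (e : V ≃ W)
    (E : Multiset (Edge R V)) (inp : Fin m → V) (out : Fin n → V) :
    mk ⟨V, hV, E, inp, out⟩ = mk ⟨W, hW, E.map (Edge.map e), e ∘ inp, e ∘ out⟩ :=
  mk_eq_mk_iff.2 ⟨e, rfl, fun _ => rfl, fun _ => rfl⟩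

end Diagram

open Classical in
/-- The map from `V` to `V` without `a` which sends `a` to `b` and fixes the other points. -/
noncomputable def collapse {V : Type} {a b : V} (hab : b ≠ a) (v : V) : {v : V // v ≠ a} :=
  ((Equiv.optionSubtypeNe a).symm v).getD ⟨b, hab⟩

theorem collapse_self {V : Type} {a b : V} (hab : b ≠ a) : collapse hab a = ⟨b, hab⟩ := by
  simp [collapse]

theorem collapse_of_ne {V : Type} {a b v : V} (hab : b ≠ a) (hv : v ≠ a) :
    collapse hab v = ⟨v, hv⟩ := by
  classical simp [collapse, Equiv.optionSubtypeNe_symm_of_ne hv]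

theorem IsQuotientBy.comp_val_collapse {V Q : Type} {a b : V} (hab : b ≠ a)
    {W : Multiset (V × V)} {π : V → Q}
    (hπ : IsQuotientBy (fun x y => (x, y) ∈ (a, b) ::ₘ W) π) :
    IsQuotientBy (fun x y => (x, y) ∈ W.map (Prod.map (collapse hab) (collapse hab)))
      (π ∘ Subtype.val) := by
  have hval : ∀ v, Quot.mk (fun x y => (x, y) ∈ (a, b) ::ₘ W) (collapse hab v).1 =
      Quot.mk _ v := fun v => by
    by_cases hv : v = a
    · subst hv
      rw [collapse_self]
      exact (Quot.sound (Multiset.mem_cons_self _ _)).symm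
    · rw [collapse_of_ne hab hv]
  refine hπ.comp Subtype.val (collapse hab) ?_ ?_ (fun x => ?_) hval
  · intro x y hxy
    obtain ⟨⟨v, w⟩, hvw, hp⟩ := Multiset.mem_map.1 hxy
    obtain ⟨rfl, rfl⟩ := Prod.mk.inj hp
    rw [hval, hval]
    exact Quot.sound (Multiset.mem_cons_of_mem hvw)
  · intro x y hxy
    rcases Multiset.mem_cons.1 hxy with h | h
    · obtain ⟨rfl, rfl⟩ := Prod.mk.inj h
      rw [collapse_self, collapse_of_ne hab hab]
    · exact Quot.sound (Multiset.mem_map_of_mem _ h)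
  · rw [collapse_of_ne hab x.2]

namespace Circuit

variable {R : Type u} [Semifield R] {m n : ℕ}

theorem spiderStep_collapse {V : Type} (hV : Finite V) {a b : V} (hab : b ≠ a)
    (E : Multiset (Edge R V)) (inp : Fin m → V) (out : Fin n → V) :
    Diagram.SpiderStep (Diagram.mk ⟨V, hV, Edge.wire a b ::ₘ E, inp, out⟩)
      (Diagram.mk ⟨{v : V // v ≠ a}, inferInstance, E.map (Edge.map (collapse hab)),
        collapse hab ∘ inp, collapse hab ∘ out⟩) := by
  classical
  refine ⟨_, _, ?_, ?_, SpiderRule.fuse {v : V // v ≠ a} inferInstance ⟨b, hab⟩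
    (E.map (Edge.map (Equiv.optionSubtypeNe a).symm)) ((Equiv.optionSubtypeNe a).symm ∘ inp)
    ((Equiv.optionSubtypeNe a).symm ∘ out)⟩
  · rw [Diagram.mk_rename hV inferInstance (Equiv.optionSubtypeNe a).symm, Multiset.map_cons,
      Edge.map_wire, Equiv.optionSubtypeNe_symm_self, Equiv.optionSubtypeNe_symm_of_ne hab]
  · rw [Edge.map_multiset_map]
    congr!

theorem spiderSteps_contract {V Q : Type} (hV : Finite V) (hQ : Finite Q) (W : Multiset (V × V))
    (E : Multiset (Edge R V)) (inp : Fin m → V) (out : Fin n → V) {π : V → Q}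
    (hπ : IsQuotientBy (fun x y => (x, y) ∈ W) π) :
    ReflTransGen Diagram.SpiderStep
      (Diagram.mk ⟨V, hV, W.map (fun p => Edge.wire p.1 p.2) + E, inp, out⟩)
      (Diagram.mk ⟨Q, hQ, E.map (Edge.map π), π ∘ inp, π ∘ out⟩) := by
  induction hl : W.card generalizing V with
  | zero =>
    obtain rfl := Multiset.card_eq_zero.1 hl
    have hinj : Function.Injective π := fun x y h =>
      congrArg (Quot.lift (fun v : V => v) fun _ _ h => absurd h (Multiset.notMem_zero _))
        (hπ.eq_iff.1 h)
    rw [Multiset.map_zero, zero_add,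
      Diagram.mk_rename hV hQ (Equiv.ofBijective π ⟨hinj, hπ.surjective⟩)]
    exact .refl
  | succ l ih =>
    obtain ⟨⟨a, b⟩, hp⟩ := Multiset.card_pos_iff_exists_mem.1 (by omega : 0 < W.card)
    obtain ⟨W, rfl⟩ := Multiset.exists_cons_of_mem hp
    have hcard : W.card = l := by simpa using hl
    rw [Multiset.map_cons, Multiset.cons_add]
    by_cases hab : b = a
    · subst hab
      refine .head ⟨_, _, rfl, rfl, .loop V hV b _ inp out⟩ (ih hV W E inp out ?_ hcard)
      refine hπ.congr (fun x y h => Quot.sound (Multiset.mem_cons_of_mem h)) fun x y h => ?_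
      rcases Multiset.mem_cons.1 h with h | h
      · obtain ⟨rfl, rfl⟩ := Prod.mk.inj h
        rfl
      · exact Quot.sound h
    · have hπc : ∀ v, π (collapse hab v).1 = π v := fun v => by
        by_cases hv : v = a
        · rw [hv, collapse_self]
          exact (hπ.eq_of_rel (Multiset.mem_cons_self _ _)).symm
        · rw [collapse_of_ne hab hv]
      refine .head (spiderStep_collapse hV hab _ inp out) ?_
      have h := ih inferInstance _ (E.map (Edge.map (collapse hab))) (collapse hab ∘ inp)
        (collapse hab ∘ out) (hπ.comp_val_collapse hab) (by simpa using hcard)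
      simpa only [Multiset.map_add, Multiset.map_map, Function.comp_def, Edge.map_wire,
        Edge.map_map, Prod.map_fst, Prod.map_snd, hπc] using h

theorem spiderSteps_of_isQuotientBy {C D : Circuit R m n} (W : Multiset (C.Node × C.Node))
    {E : Multiset (Edge R C.Node)} (hC : C.edges = W.map (fun p => Edge.wire p.1 p.2) + E)
    {π : C.Node → D.Node} (hπ : IsQuotientBy (fun x y => (x, y) ∈ W) π)
    (hD : D.edges = E.map (Edge.map π)) (hinp : ∀ i, D.inp i = π (C.inp i))
    (hout : ∀ j, D.out j = π (C.out j)) :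
    ReflTransGen Diagram.SpiderStep (Diagram.mk C) (Diagram.mk D) := by
  have hinp' : D.inp = π ∘ C.inp := funext hinp
  have hout' : D.out = π ∘ C.out := funext hout
  have h := spiderSteps_contract C.finite_node D.finite_node W E C.inp C.out hπ
  rwa [← hC, ← hD, ← hinp', ← hout'] at h

end Circuit

namespace PositiveRig

variable {R : Type u} [Semifield R] [PositiveRig R]

theorem eq_zero_of_sum_eq_zero {ι : Type*} {s : Finset ι} {f : ι → R} (h : ∑ i ∈ s, f i = 0)
    {i : ι} (hi : i ∈ s) : f i = 0 := by
  classical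
  rw [← Finset.add_sum_erase _ _ hi] at h
  exact (eq_zero_of_add_eq_zero _ _ h).1

/-- Both sides eliminate two nodes `x` and `y` from the weight between `a` and `b`: `m` is the
weight between `x` and `y`, while `A` and `B` are the total weights from `x` and from `y` to all
other nodes. -/
theorem eliminate_exchange (w m A B ax xb ay yb : R) (hax : A = 0 → ax = 0) (hxb : A = 0 → xb = 0)
    (hay : B = 0 → ay = 0) (hyb : B = 0 → yb = 0) :
    w + ax * xb / (m + A) +
        (ay + ax * m / (m + A)) * (yb + m * xb / (m + A)) / (B + m * A / (m + A)) =
      w + ay * yb / (m + B) +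
        (ax + ay * m / (m + B)) * (xb + m * yb / (m + B)) / (A + m * B / (m + B)) := by
  by_cases hA : m + A = 0
  · obtain ⟨rfl, rfl⟩ := eq_zero_of_add_eq_zero _ _ hA
    simp [hax rfl, hxb rfl]
  by_cases hB : m + B = 0
  · obtain ⟨rfl, rfl⟩ := eq_zero_of_add_eq_zero _ _ hB
    simp [hay rfl, hyb rfl]
  by_cases hD : A * (B + m) + m * B = 0
  · obtain ⟨hAB, hmB⟩ := eq_zero_of_add_eq_zero _ _ hD
    have hA0 : A = 0 := (mul_eq_zero.1 hAB).resolve_right (by rwa [add_comm])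
    have hm : m ≠ 0 := by simpa [hA0] using hA
    have hB0 : B = 0 := (mul_eq_zero.1 hmB).resolve_left hm
    simp [hax hA0, hay hB0]
  have hAm : B + m * A / (m + A) = (A * (B + m) + m * B) / (m + A) := by
    field_simp
    ring
  have hBm : A + m * B / (m + B) = (A * (B + m) + m * B) / (m + B) := by
    field_simp
    ring
  rw [hAm, hBm]
  field_simp
  ring

end PositiveRig

/-- A weighted graph on `Q`, the weights being conductances or `0`.  There are no loops: a
resistor from a node to itself has no effect. -/
@[ext] structure Network (R : Type u) [Semifield R] (Q : Type) where
  val : Q → Q → R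
  symm : ∀ a b, val a b = val b a
  diag : ∀ a, val a a = 0

namespace Network

section Elimination

variable {R : Type u} [Semifield R] {Q : Type} [Fintype Q]

open Classical in
/-- Elimination of the node `x` by the star-to-mesh transformation.  The node is not removed but
becomes isolated; if it was isolated before, then the division by `0` does no harm. -/
noncomputable def elim (x : Q) (w : Network R Q) : Network R Q where
  val a b := if a = x ∨ b = x ∨ a = b then 0
    else w.val a b + w.val a x * w.val x b / ∑ c, w.val x c
  symm a b := by
    refine if_congr (by tauto) rfl ?_
    rw [w.symm a b, w.symm a x, w.symm x b, mul_comm]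
  diag a := by simp

theorem elim_val_of_ne (w : Network R Q) {x a b : Q} (ha : a ≠ x) (hb : b ≠ x) (hab : a ≠ b) :
    (w.elim x).val a b = w.val a b + w.val a x * w.val x b / ∑ c, w.val x c := by
  simp [elim, ha, hb, hab]

theorem elim_val_left (w : Network R Q) (x b : Q) : (w.elim x).val x b = 0 := by
  simp [elim]

theorem elim_val_right (w : Network R Q) (x a : Q) : (w.elim x).val a x = 0 := by
  simp [elim]

theorem elim_elim_self (w : Network R Q) (x : Q) : (w.elim x).elim x = w.elim x := by
  ext a b
  by_cases ha : a = x
  · rw [ha, elim_val_left, elim_val_left]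
  by_cases hb : b = x
  · rw [hb, elim_val_right, elim_val_right]
  by_cases hab : a = b
  · rw [hab, diag, diag]
  rw [elim_val_of_ne _ ha hb hab, elim_val_right, zero_mul, zero_div, add_zero]

section TwoNodes

variable [DecidableEq Q] {x y : Q}

theorem sum_val_eq (w : Network R Q) (hxy : x ≠ y) :
    ∑ c, w.val x c = w.val x y + ∑ c ∈ {x, y}ᶜ, w.val x c := by
  rw [← Finset.sum_add_sum_compl {x, y}, Finset.sum_pair hxy, w.diag, zero_add]

theorem sum_elim_val (w : Network R Q) (hxy : x ≠ y) :
    ∑ c, (w.elim x).val y c = ∑ c ∈ {x, y}ᶜ, w.val y c +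
      w.val x y * (∑ c ∈ {x, y}ᶜ, w.val x c) / (w.val x y + ∑ c ∈ {x, y}ᶜ, w.val x c) := by
  rw [sum_val_eq _ hxy.symm, elim_val_right, zero_add, Finset.pair_comm, Finset.mul_sum,
    Finset.sum_div, ← Finset.sum_add_distrib]
  refine Finset.sum_congr rfl fun c hc => ?_
  obtain ⟨hcx, hcy⟩ : c ≠ x ∧ c ≠ y := by simpa using hc
  rw [elim_val_of_ne _ hxy.symm hcx hcy.symm, sum_val_eq _ hxy, w.symm y x]

theorem elim_elim_val_of_ne (w : Network R Q) (hxy : x ≠ y) {a b : Q}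
    (ha : a ∈ ({x, y} : Finset Q)ᶜ) (hb : b ∈ ({x, y} : Finset Q)ᶜ) (hab : a ≠ b) :
    ((w.elim x).elim y).val a b =
      w.val a b + w.val a x * w.val x b / (w.val x y + ∑ c ∈ {x, y}ᶜ, w.val x c) +
        (w.val a y + w.val a x * w.val x y / (w.val x y + ∑ c ∈ {x, y}ᶜ, w.val x c)) *
          (w.val y b + w.val x y * w.val x b / (w.val x y + ∑ c ∈ {x, y}ᶜ, w.val x c)) /
        (∑ c ∈ {x, y}ᶜ, w.val y c +
          w.val x y * (∑ c ∈ {x, y}ᶜ, w.val x c) / (w.val x y + ∑ c ∈ {x, y}ᶜ, w.val x c)) := by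
  obtain ⟨hax, hay⟩ : a ≠ x ∧ a ≠ y := by simpa using ha
  obtain ⟨hbx, hby⟩ : b ≠ x ∧ b ≠ y := by simpa using hb
  rw [elim_val_of_ne _ hay hby hab, elim_val_of_ne _ hax hbx hab,
    elim_val_of_ne _ hax hxy.symm hay, elim_val_of_ne _ hxy.symm hbx hby.symm, sum_elim_val _ hxy,
    sum_val_eq _ hxy, w.symm y x]

theorem elim_elim_val_of_notMem (w : Network R Q) {a b : Q}
    (h : a ∉ ({x, y} : Finset Q)ᶜ ∨ b ∉ ({x, y} : Finset Q)ᶜ ∨ a = b) :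
    ((w.elim x).elim y).val a b = 0 := by
  by_cases ha : a = y
  · rw [ha, elim_val_left]
  by_cases hb : b = y
  · rw [hb, elim_val_right]
  by_cases hab : a = b
  · rw [hab, diag]
  rw [elim_val_of_ne _ ha hb hab]
  obtain rfl | rfl : a = x ∨ b = x := by simpa [ha, hb, hab] using h
  · simp [elim_val_left]
  · simp [elim_val_right]

end TwoNodes

variable [PositiveRig R]

theorem elim_comm (w : Network R Q) (x y : Q) : (w.elim x).elim y = (w.elim y).elim x := by
  classical
  rcases eq_or_ne x y with rfl | hxy
  · rfl
  ext a b
  by_cases h : a ∉ ({x, y} : Finset Q)ᶜ ∨ b ∉ ({x, y} : Finset Q)ᶜ ∨ a = b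
  · rw [elim_elim_val_of_notMem w h, elim_elim_val_of_notMem w (by rwa [Finset.pair_comm])]
  obtain ⟨ha, hb, hab⟩ : a ∈ ({x, y} : Finset Q)ᶜ ∧ b ∈ ({x, y} : Finset Q)ᶜ ∧ a ≠ b := by
    simpa only [not_or, not_not] using h
  have hzero : ∀ {z c : Q}, c ∈ ({x, y} : Finset Q)ᶜ → ∑ c ∈ {x, y}ᶜ, w.val z c = 0 →
      w.val z c = 0 := fun hc h => PositiveRig.eq_zero_of_sum_eq_zero h hc
  rw [elim_elim_val_of_ne w hxy ha hb hab, elim_elim_val_of_ne w hxy.symm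
    (by rwa [Finset.pair_comm]) (by rwa [Finset.pair_comm]) hab, Finset.pair_comm y x, w.symm y x]
  refine PositiveRig.eliminate_exchange _ _ _ _ _ _ _ _ ?_ (hzero hb) ?_ (hzero hb)
  · rw [w.symm a x]
    exact hzero ha
  · rw [w.symm a y]
    exact hzero ha

instance : LeftCommutative (elim : Q → Network R Q → Network R Q) :=
  ⟨fun x y w => elim_comm w y x⟩

/-- Elimination of the nodes of a finite set; the order does not matter. -/
noncomputable def elimAll (s : Finset Q) (w : Network R Q) : Network R Q :=
  s.val.foldr elim w

theorem elimAll_empty (w : Network R Q) : w.elimAll ∅ = w := rfl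

theorem elimAll_insert [DecidableEq Q] {x : Q} {s : Finset Q} (hx : x ∉ s) (w : Network R Q) :
    w.elimAll (insert x s) = (w.elimAll s).elim x := by
  simp [elimAll, Finset.insert_val_of_notMem hx]

theorem elim_elimAll (w : Network R Q) (x : Q) (s : Finset Q) :
    (w.elim x).elimAll s = (w.elimAll s).elim x := by
  classical
  induction s using Finset.induction_on with
  | empty => rfl
  | insert y s hy ih => rw [elimAll_insert hy, elimAll_insert hy, ih, elim_comm]

theorem elim_elimAll_of_mem (w : Network R Q) {x : Q} {s : Finset Q} (hx : x ∈ s) :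
    (w.elim x).elimAll s = w.elimAll s := by
  classical
  rw [elim_elimAll, ← Finset.insert_erase hx, elimAll_insert (Finset.notMem_erase x s),
    elim_elim_self]

open Classical in
/-- The weights between the terminals `t i` after all other nodes have been eliminated. -/
noncomputable def response (w : Network R Q) {T : Type} (t : T → Q) (i j : T) : R :=
  (w.elimAll {q | q ∉ Set.range t}).val (t i) (t j)

theorem elim_response (w : Network R Q) {T : Type} {t : T → Q} {x : Q} (hx : x ∉ Set.range t) :
    (w.elim x).response t = w.response t := by
  unfold response
  rw [elim_elimAll_of_mem _ (by simpa using hx)]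

theorem response_of_surjective (w : Network R Q) {T : Type} {t : T → Q}
    (ht : Function.Surjective t) (i j : T) : w.response t i j = w.val (t i) (t j) := by
  simp [response, ht.range_eq, elimAll_empty]

end Elimination

section Extends

variable {R : Type u} [Semifield R] {Q Q' : Type}

/-- The network `w'` consists of a copy of `w` on the range of `f`, and of further nodes which are
not joined to this copy. -/
structure Extends (f : Q → Q') (w : Network R Q) (w' : Network R Q') : Prop where
  val_map : ∀ a b, w'.val (f a) (f b) = w.val a b
  val_of_notMem_range : ∀ a, ∀ z ∉ Set.range f, w'.val (f a) z = 0

variable [Fintype Q'] {f : Q → Q'} {w : Network R Q} {w' : Network R Q'}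

theorem Extends.elim_of_notMem_range (h : Extends f w w') {z : Q'} (hz : z ∉ Set.range f) :
    Extends f w (w'.elim z) := by
  have hne : ∀ a, f a ≠ z := fun a ha => hz ⟨a, ha⟩
  constructor
  · intro a b
    by_cases hab : f a = f b
    · rw [hab, diag, ← h.val_map, hab, diag]
    rw [elim_val_of_ne _ (hne a) (hne b) hab, h.val_of_notMem_range a z hz, zero_mul, zero_div,
      add_zero, h.val_map]
  · intro a c hc
    simp [Network.elim, h.val_of_notMem_range _ _ hz, h.val_of_notMem_range _ _ hc]

variable [Fintype Q]

theorem Extends.elim (h : Extends f w w') (hf : Function.Injective f) (x : Q) :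
    Extends f (w.elim x) (w'.elim (f x)) := by
  have hsum : ∑ c, w.val x c = ∑ z, w'.val (f x) z :=
    Fintype.sum_of_injective f hf _ _ (h.val_of_notMem_range x) fun c => (h.val_map x c).symm
  constructor
  · intro a b
    simp only [Network.elim, h.val_map, hsum]
    classical exact if_congr (or_congr hf.eq_iff (or_congr hf.eq_iff hf.eq_iff)) rfl rfl
  · intro a z hz
    simp [Network.elim, h.val_of_notMem_range _ z hz]

variable [PositiveRig R]

theorem Extends.elimAll (h : Extends f w w') (hf : Function.Injective f) (s : Finset Q') :
    Extends f (w.elimAll (s.preimage f hf.injOn)) (w'.elimAll s) := by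
  classical
  induction s using Finset.induction_on with
  | empty => rwa [Finset.preimage_empty, elimAll_empty, elimAll_empty]
  | insert z s hz ih =>
    rw [elimAll_insert hz]
    by_cases hzf : z ∈ Set.range f
    · obtain ⟨x, rfl⟩ := hzf
      have hs : (insert (f x) s).preimage f hf.injOn = insert x (s.preimage f hf.injOn) := by
        ext q
        simp [hf.eq_iff]
      rw [hs, elimAll_insert (by simpa using hz)]
      exact ih.elim hf x
    · have hs : (insert z s).preimage f hf.injOn = s.preimage f hf.injOn := by
        ext q
        have hq : f q ≠ z := fun hq => hzf ⟨q, hq⟩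
        simp [hq]
      rw [hs]
      exact ih.elim_of_notMem_range hzf

theorem Extends.response_eq (h : Extends f w w') (hf : Function.Injective f) {T : Type}
    (t : T → Q) : w'.response (f ∘ t) = w.response t := by
  classical
  ext i j
  unfold response
  rw [Function.comp_apply, Function.comp_apply, (h.elimAll hf _).val_map]
  congr 2
  ext q
  simp [hf.eq_iff]

end Extends

end Network

namespace Link

variable {R : Type u} [Semifield R]

/-- The conductance of a link in a circuit whose wires have been contracted; wires, which have
become loops there, do not count. -/
def value : Link R → R
  | wire => 0
  | resistor y => y.1

end Link

namespace Edge

variable {R : Type u} [Semifield R] {V W : Type}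

open Classical in
/-- The contribution of an edge to the weight between `a` and `b`. -/
noncomputable def weight (e : Edge R V) (a b : V) : R :=
  if a ≠ b ∧ e.1 = s(a, b) then e.2.value else 0

theorem weight_of_eq {e : Edge R V} {a b : V} (hab : a ≠ b) (he : e.1 = s(a, b)) :
    e.weight a b = e.2.value :=
  if_pos ⟨hab, he⟩

theorem weight_of_ne {e : Edge R V} {a b : V} (he : e.1 ≠ s(a, b)) : e.weight a b = 0 :=
  if_neg fun h => he h.2

theorem weight_self (e : Edge R V) (a : V) : e.weight a a = 0 := if_neg fun h => h.1 rfl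

theorem weight_symm (e : Edge R V) (a b : V) : e.weight a b = e.weight b a := by
  classical
  exact if_congr (by rw [ne_comm, Sym2.eq_swap]) rfl rfl

theorem weight_map {f : V → W} (hf : Function.Injective f) (e : Edge R V) (a b : V) :
    (map f e).weight (f a) (f b) = e.weight a b := by
  classical
  refine if_congr ?_ rfl rfl
  rw [hf.ne_iff, map, ← Sym2.map_mk, (Sym2.map.injective hf).eq_iff]

theorem weight_map_of_notMem_range {f : V → W} (e : Edge R V) {a : W} (ha : a ∉ Set.range f)
    (b : W) : (map f e).weight a b = 0 := by
  refine weight_of_ne fun h => ha ?_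
  obtain ⟨v, -, hv⟩ := Sym2.mem_map.1 (h.symm ▸ Sym2.mem_mk_left a b : a ∈ (map f e).1)
  exact ⟨v, hv⟩

theorem weight_wire (u v a b : V) : (wire u v : Edge R V).weight a b = 0 := ite_self _

open Classical in
theorem weight_resistor_of_ne {a b : V} (hab : a ≠ b) (u v : V) (y : Conductance R) :
    (resistor u v y).weight a b =
      (if u = a ∧ v = b then y.1 else 0) + if v = a ∧ u = b then y.1 else 0 := by
  by_cases h : s(u, v) = s(a, b)
  · rw [weight_of_eq hab h]
    rcases Sym2.eq_iff.1 h with ⟨rfl, rfl⟩ | ⟨rfl, rfl⟩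
    · simp [hab, resistor, Link.value]
    · simp [hab, resistor, Link.value]
  · rw [weight_of_ne h, if_neg, if_neg, add_zero]
    · rintro ⟨rfl, rfl⟩
      exact h Sym2.eq_swap
    · rintro ⟨rfl, rfl⟩
      exact h rfl

theorem weight_resistor_self (u a b : V) (y : Conductance R) :
    (resistor u u y).weight a b = 0 := by
  rcases eq_or_ne a b with rfl | hab
  · exact weight_self _ a
  · refine weight_of_ne fun h => hab ?_
    rcases Sym2.eq_iff.1 h with ⟨ha, hb⟩ | ⟨hb, ha⟩ <;> exact ha.symm.trans hb

theorem weight_resistor_add [PositiveRig R] (u v a b : V) (y z : Conductance R) :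
    (resistor u v (y.add z)).weight a b =
      (resistor u v y).weight a b + (resistor u v z).weight a b := by
  by_cases h : a ≠ b ∧ s(u, v) = s(a, b)
  · rw [weight_of_eq h.1 h.2, weight_of_eq h.1 h.2, weight_of_eq h.1 h.2]
    rfl
  · exact (if_neg h).trans ((add_zero (0 : R)).symm.trans
      (congrArg₂ _ (if_neg h).symm (if_neg h).symm))

theorem wire_eq_wire_iff {a b u v : V} :
    (wire a b : Edge R V) = wire u v ↔ (a = u ∧ b = v) ∨ (a = v ∧ b = u) := by
  simp [wire]

theorem wire_ne_resistor (a b u v : V) (y : Conductance R) :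
    (wire a b : Edge R V) ≠ resistor u v y := by
  simp [wire, resistor]

theorem wire_mem_map_iff {f : V → W} {E : Multiset (Edge R V)} {a b : W} :
    wire a b ∈ E.map (map f) ↔ ∃ u v, wire u v ∈ E ∧ f u = a ∧ f v = b := by
  constructor
  · intro h
    obtain ⟨⟨p, l⟩, he, hab⟩ := Multiset.mem_map.1 h
    induction p using Sym2.ind with
    | _ u v =>
      obtain ⟨huv, rfl⟩ := Prod.mk.inj hab
      rcases Sym2.eq_iff.1 huv with ⟨hu, hv⟩ | ⟨hu, hv⟩
      · exact ⟨u, v, he, hu, hv⟩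
      · exact ⟨v, u, (wire_comm (R := R) u v).subst (motive := (· ∈ E)) he, hv, hu⟩
  · rintro ⟨u, v, huv, rfl, rfl⟩
    rw [← map_wire]
    exact Multiset.mem_map_of_mem _ huv

end Edge

namespace Network

variable {R : Type u} [Semifield R] {V W : Type}

/-- The network of the edges `E`: the conductances of parallel resistors are added up. -/
noncomputable def ofEdges (E : Multiset (Edge R V)) : Network R V where
  val a b := (E.map fun e => e.weight a b).sum
  symm a b := by simp only [Edge.weight_symm _ a b]
  diag a := by simp [Edge.weight_self]

theorem ofEdges_cons_val (e : Edge R V) (E : Multiset (Edge R V)) (a b : V) :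
    (ofEdges (e ::ₘ E)).val a b = e.weight a b + (ofEdges E).val a b := by
  simp [ofEdges]

theorem ofEdges_add_val (E E' : Multiset (Edge R V)) (a b : V) :
    (ofEdges (E + E')).val a b = (ofEdges E).val a b + (ofEdges E').val a b := by
  simp [ofEdges]

theorem ofEdges_map_val {f : V → W} (hf : Function.Injective f) (E : Multiset (Edge R V))
    (a b : V) : (ofEdges (E.map (Edge.map f))).val (f a) (f b) = (ofEdges E).val a b := by
  simp [ofEdges, Edge.weight_map hf]

theorem ofEdges_map_val_of_notMem_range {f : V → W} (E : Multiset (Edge R V)) {a : W}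
    (ha : a ∉ Set.range f) (b : W) : (ofEdges (E.map (Edge.map f))).val a b = 0 := by
  simp [ofEdges, Edge.weight_map_of_notMem_range _ ha]

theorem extends_ofEdges_map (e : V ≃ W) (E : Multiset (Edge R V)) :
    Extends e (ofEdges E) (ofEdges (E.map (Edge.map e))) where
  val_map := ofEdges_map_val e.injective E
  val_of_notMem_range _ z hz := absurd (e.surjective z) hz

section Behaviour

variable [PositiveRig R] [Fintype V] {T : Type}

/-- What can be measured at the terminals `t`: which of them coincide, and the response. -/
noncomputable def behaviour (w : Network R V) (t : T → V) : (T → T → Prop) × (T → T → R) :=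
  (fun i j => t i = t j, w.response t)

theorem elim_behaviour (w : Network R V) {t : T → V} {x : V} (hx : x ∉ Set.range t) :
    (w.elim x).behaviour t = w.behaviour t := by
  rw [behaviour, behaviour, elim_response w hx]

theorem Extends.behaviour_eq [Fintype W] {f : V → W} {w : Network R V} {w' : Network R W}
    (h : Extends f w w') (hf : Function.Injective f) (t : T → V) :
    w'.behaviour (f ∘ t) = w.behaviour t := by
  simp only [behaviour, h.response_eq hf, Function.comp_apply, hf.eq_iff]

end Behaviour

end Network

section StarMesh

variable {R : Type u} [Semifield R] {V W : Type} {k : ℕ}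

/-- The edges of a star with centre `x`, whose `i`-th arm has conductance `y i` and ends at
`a i`. -/
def Circuit.starEdges (x : V) (a : Fin k → V) (y : Fin k → Conductance R) :
    Multiset (Edge R V) :=
  (Finset.univ : Finset (Fin k)).val.map fun i => Edge.resistor x (a i) (y i)

theorem Circuit.map_starEdges (f : V → W) (x : V) (a : Fin k → V) (y : Fin k → Conductance R) :
    (starEdges x a y).map (Edge.map f) = starEdges (f x) (f ∘ a) y :=
  Multiset.map_map _ _ _

theorem Circuit.wire_notMem_starEdges (u v x : V) (a : Fin k → V) (y : Fin k → Conductance R) :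
    Edge.wire u v ∉ starEdges x a y := by
  simp [starEdges, (Edge.wire_ne_resistor _ _ _ _ _).symm]

theorem Circuit.map_meshEdges [PositiveRig R] (f : V → W) (a : Fin k → V)
    (y : Fin k → Conductance R) :
    (meshEdges a y).map (Edge.map f) = meshEdges (f ∘ a) y :=
  Multiset.map_map _ _ _

theorem Circuit.wire_notMem_meshEdges [PositiveRig R] (u v : V) (a : Fin k → V)
    (y : Fin k → Conductance R) : Edge.wire u v ∉ meshEdges a y := by
  simp [meshEdges, (Edge.wire_ne_resistor _ _ _ _ _).symm]

open Classical in
/-- The total conductance of the arms that end at `v`. -/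
noncomputable def armSum (a : Fin k → V) (y : Fin k → Conductance R) (v : V) : R :=
  ∑ i, if a i = v then (y i).1 else 0

theorem sum_armSum [Fintype V] (a : Fin k → V) (y : Fin k → Conductance R) :
    ∑ v, armSum a y v = ∑ i, (y i).1 := by
  classical
  unfold armSum
  rw [Finset.sum_comm]
  simp

theorem armSum_comp {f : V → W} (hf : Function.Injective f) (a : Fin k → V)
    (y : Fin k → Conductance R) (v : V) : armSum (f ∘ a) y (f v) = armSum a y v := by
  classical
  exact Finset.sum_congr rfl fun i _ => if_congr hf.eq_iff rfl rfl

theorem sum_filter_lt_add_swap {M ι : Type*} [AddCommMonoid M] [Fintype ι] [LinearOrder ι]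
    (g : ι → ι → M) (hg : ∀ i, g i i = 0) :
    ∑ p : ι × ι with p.1 < p.2, (g p.1 p.2 + g p.2 p.1) = ∑ p : ι × ι, g p.1 p.2 := by
  have hswap : ∑ p : ι × ι with p.1 < p.2, g p.2 p.1 = ∑ p : ι × ι with p.2 < p.1, g p.1 p.2 :=
    Finset.sum_equiv (Equiv.prodComm ι ι) (by simp) (by simp)
  rw [Finset.sum_add_distrib, hswap, Finset.sum_filter, Finset.sum_filter,
    ← Finset.sum_add_distrib]
  refine Finset.sum_congr rfl fun p _ => ?_
  obtain ⟨i, j⟩ := p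
  rcases lt_trichotomy i j with h | rfl | h
  · simp [h, h.not_gt]
  · simp [hg]
  · simp [h, h.not_gt]

namespace Network

theorem ofEdges_starEdges_val_center (x : V) (a : Fin k → V) (y : Fin k → Conductance R) {v : V}
    (hv : x ≠ v) : (ofEdges (Circuit.starEdges x a y)).val x v = armSum a y v := by
  simp only [ofEdges, Circuit.starEdges, Multiset.map_map, armSum]
  refine Finset.sum_congr rfl fun i _ => ?_
  by_cases hi : a i = v
  · rw [if_pos hi, Function.comp_apply, hi, Edge.weight_of_eq hv rfl]
    rfl
  · rw [if_neg hi, Function.comp_apply, Edge.weight_of_ne]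
    simp [Edge.resistor, hi, hv]

theorem ofEdges_starEdges_val_of_ne (x : V) (a : Fin k → V) (y : Fin k → Conductance R)
    {u v : V} (hu : x ≠ u) (hv : x ≠ v) :
    (ofEdges (Circuit.starEdges x a y)).val u v = 0 := by
  simp only [ofEdges, Circuit.starEdges, Multiset.map_map]
  refine Finset.sum_eq_zero fun i _ => Edge.weight_of_ne ?_
  simp [Edge.resistor, hu, hv]

variable [PositiveRig R]

theorem ofEdges_meshEdges_val (a : Fin k → V) (y : Fin k → Conductance R) {u v : V}
    (huv : u ≠ v) : (ofEdges (Circuit.meshEdges a y)).val u v =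
      armSum a y u * armSum a y v / ∑ i, (y i).1 := by
  classical
  have hmesh : ∀ i j, (Conductance.mesh y j i).1 = (Conductance.mesh y i j).1 := fun i j => by
    simp only [Conductance.mesh, mul_comm]
  have hterm : ∀ i j, (Edge.resistor (a i) (a j) (Conductance.mesh y i j)).weight u v =
      (if a i = u ∧ a j = v then (Conductance.mesh y i j).1 else 0) +
        if a j = u ∧ a i = v then (Conductance.mesh y j i).1 else 0 := fun i j => by
    rw [Edge.weight_resistor_of_ne huv, hmesh]
  have hdiag : ∀ i, (if a i = u ∧ a i = v then (Conductance.mesh y i i).1 else 0) = 0 :=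
    fun i => if_neg fun h => huv (h.1.symm.trans h.2)
  calc (ofEdges (Circuit.meshEdges a y)).val u v
      = ∑ p : Fin k × Fin k with p.1 < p.2,
          (Edge.resistor (a p.1) (a p.2) (Conductance.mesh y p.1 p.2)).weight u v := by
        simp only [ofEdges, Circuit.meshEdges, Multiset.map_map]
        rfl
    _ = ∑ p : Fin k × Fin k,
          if a p.1 = u ∧ a p.2 = v then (Conductance.mesh y p.1 p.2).1 else 0 := by
        simp only [hterm]
        exact sum_filter_lt_add_swap
          (fun i j => if a i = u ∧ a j = v then (Conductance.mesh y i j).1 else 0) hdiag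
    _ = armSum a y u * armSum a y v / ∑ i, (y i).1 := by
        rw [armSum, armSum, Finset.sum_mul_sum, ← Finset.sum_product', Finset.sum_div]
        refine Finset.sum_congr rfl fun p _ => ?_
        by_cases hu : a p.1 = u <;> by_cases hv : a p.2 = v <;>
          simp [hu, hv, Conductance.mesh]

theorem extends_meshEdges_elim_starEdges [Fintype V] (a : Fin k → V) (y : Fin k → Conductance R)
    (E : Multiset (Edge R V)) :
    Extends some (ofEdges (Circuit.meshEdges a y + E))
      ((ofEdges (Circuit.starEdges none (some ∘ a) y + E.map (Edge.map some))).elim none) := by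
  set w := ofEdges (Circuit.starEdges none (some ∘ a) y + E.map (Edge.map some)) with hw
  have hnone : ∀ v, w.val none (some v) = armSum a y v := fun v => by
    rw [hw, ofEdges_add_val, ofEdges_starEdges_val_center _ _ _ (by simp),
      ofEdges_map_val_of_notMem_range _ (by simp), add_zero,
      armSum_comp (Option.some_injective V)]
  have hsome : ∀ u v, w.val (some u) (some v) = (ofEdges E).val u v := fun u v => by
    rw [hw, ofEdges_add_val, ofEdges_starEdges_val_of_ne _ _ _ (by simp) (by simp), zero_add,
      ofEdges_map_val (Option.some_injective V)]
  have hsum : ∑ z, w.val none z = ∑ i, (y i).1 := by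
    simp only [Fintype.sum_option, w.diag, zero_add, hnone, sum_armSum]
  constructor
  · intro u v
    rcases eq_or_ne u v with rfl | huv
    · rw [diag, diag]
    rw [elim_val_of_ne _ (by simp) (by simp) (by simpa using huv), hsum, hsome,
      w.symm (some u), hnone, hnone, ofEdges_add_val, ofEdges_meshEdges_val _ _ huv, add_comm]
  · intro u z hz
    obtain rfl : z = none := Option.eq_none_iff_forall_not_mem.2 fun v hv => hz ⟨v, hv.symm⟩
    exact elim_val_right _ _ _

end Network

end StarMesh

theorem IsQuotientBy.optionMap {V Q : Type*} {s : V → V → Prop} {π : V → Q}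
    (hπ : IsQuotientBy s π) {r : Option V → Option V → Prop}
    (hr : ∀ x y, r x y ↔ ∃ u v, s u v ∧ some u = x ∧ some v = y) :
    IsQuotientBy r (Option.map π) where
  surjective := by
    rintro (_ | q)
    · exact ⟨none, rfl⟩
    · obtain ⟨v, rfl⟩ := hπ.surjective q
      exact ⟨some v, rfl⟩
  eq_iff {x y} := by
    constructor
    · intro h
      rcases x with _ | u <;> rcases y with _ | v
      · rfl
      · simp at h
      · simp at h
      · exact congrArg (Quot.lift (fun v => Quot.mk r (some v)) fun u v huv =>
          Quot.sound ((hr _ _).2 ⟨u, v, huv, rfl, rfl⟩)) (hπ.eq_iff.1 (by simpa using h))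
    · refine fun h => congrArg (Quot.lift (Option.map π) fun x y hxy => ?_) h
      obtain ⟨u, v, huv, rfl, rfl⟩ := (hr x y).1 hxy
      exact congrArg some (hπ.eq_of_rel huv)

namespace Circuit

variable {R : Type u} [Semifield R] {m n : ℕ}

/-- The node of an input or output. -/
def terminal (C : Circuit R m n) : Fin m ⊕ Fin n → C.Node := Sum.elim C.inp C.out

theorem isExternal_iff {C : Circuit R m n} {v : C.Node} :
    C.IsExternal v ↔ v ∈ Set.range C.terminal := by
  simp [IsExternal, terminal]

/-- There is a wire between the two nodes. -/
def Wired (C : Circuit R m n) (u v : C.Node) : Prop := Edge.wire u v ∈ C.edges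

variable [PositiveRig R]

/-- The behaviour of a circuit at its inputs and outputs: that of the network obtained by
contracting the wires. -/
noncomputable def behaviour (C : Circuit R m n) :
    (Fin m ⊕ Fin n → Fin m ⊕ Fin n → Prop) × (Fin m ⊕ Fin n → Fin m ⊕ Fin n → R) :=
  have := C.finite_node
  letI := Fintype.ofFinite (Quot C.Wired)
  (Network.ofEdges (C.edges.map (Edge.map (Quot.mk C.Wired)))).behaviour
    (Quot.mk C.Wired ∘ C.terminal)

theorem behaviour_eq (C : Circuit R m n) {Q : Type} [Fintype Q] {π : C.Node → Q}
    (hπ : IsQuotientBy C.Wired π) :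
    C.behaviour = (Network.ofEdges (C.edges.map (Edge.map π))).behaviour (π ∘ C.terminal) := by
  have := C.finite_node
  let := Fintype.ofFinite (Quot C.Wired)
  obtain ⟨e, he⟩ := (IsQuotientBy.quotMk C.Wired).exists_equiv hπ
  obtain rfl : π = e ∘ Quot.mk C.Wired := (funext he).symm
  rw [← Edge.map_multiset_map]
  exact ((Network.extends_ofEdges_map e _).behaviour_eq e.injective _).symm

theorem behaviour_eq_of_map {C D : Circuit R m n} (f : C.Node → D.Node)
    (hf : IsQuotientBy C.Wired (Quot.mk D.Wired ∘ f))
    (hE : Network.ofEdges (C.edges.map (Edge.map (Quot.mk D.Wired ∘ f))) =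
      Network.ofEdges (D.edges.map (Edge.map (Quot.mk D.Wired))))
    (hinp : ∀ i, f (C.inp i) = D.inp i) (hout : ∀ j, f (C.out j) = D.out j) :
    C.behaviour = D.behaviour := by
  have := D.finite_node
  let := Fintype.ofFinite (Quot D.Wired)
  have ht : f ∘ C.terminal = D.terminal := by
    ext (i | j)
    exacts [hinp i, hout j]
  rw [C.behaviour_eq hf, D.behaviour_eq (IsQuotientBy.quotMk D.Wired), hE, ← ht]
  rfl

theorem Iso.behaviour_eq {C D : Circuit R m n} (h : C.Iso D) : C.behaviour = D.behaviour := by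
  obtain ⟨e, he, hinp, hout⟩ := h
  have hwired : ∀ u v, D.Wired u v ↔ ∃ x y, C.Wired x y ∧ e x = u ∧ e y = v := fun u v => by
    rw [Wired, ← he]
    exact Edge.wire_mem_map_iff
  refine behaviour_eq_of_map e ((IsQuotientBy.quotMk D.Wired).comp e e.symm ?_ ?_ ?_ ?_) ?_
    hinp hout
  · exact fun u v huv => Quot.sound ((hwired _ _).2 ⟨u, v, huv, rfl, rfl⟩)
  · intro u v huv
    obtain ⟨x, y, hxy, rfl, rfl⟩ := (hwired u v).1 huv
    rw [e.symm_apply_apply, e.symm_apply_apply]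
    exact Quot.sound hxy
  · exact fun x => congrArg _ (e.symm_apply_apply x)
  · exact fun x => congrArg _ (e.apply_symm_apply x)
  · rw [← Edge.map_multiset_map, he]

theorem behaviour_fuse {V : Type} (hV : Finite V) (u : V) (E : Multiset (Edge R (Option V)))
    (inp : Fin m → Option V) (out : Fin n → Option V) :
    behaviour ⟨Option V, inferInstance, Edge.wire none (some u) ::ₘ E, inp, out⟩ =
      behaviour ⟨V, hV, E.map (Edge.map fun v => v.getD u), fun i => (inp i).getD u,
        fun j => (out j).getD u⟩ := by
  let C : Circuit R m n := ⟨Option V, inferInstance, Edge.wire none (some u) ::ₘ E, inp, out⟩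
  have hsome : ∀ v : Option V, Quot.mk C.Wired (some (v.getD u)) = Quot.mk _ v := by
    rintro (_ | v)
    · exact (Quot.sound (Multiset.mem_cons_self _ _)).symm
    · rfl
  refine behaviour_eq_of_map (C := C) (fun v => v.getD u)
    ((IsQuotientBy.quotMk _).comp (fun v => v.getD u) some ?_ ?_ hsome fun _ => rfl) ?_
    (fun _ => rfl) (fun _ => rfl)
  · intro x y hxy
    rcases Multiset.mem_cons.1 hxy with hxy | hxy
    · rcases Edge.wire_eq_wire_iff.1 hxy with ⟨rfl, rfl⟩ | ⟨rfl, rfl⟩ <;> rfl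
    · exact Quot.sound (Edge.wire_mem_map_iff.2 ⟨x, y, hxy, rfl, rfl⟩)
  · intro x y hxy
    obtain ⟨v, w, hvw, rfl, rfl⟩ := Edge.wire_mem_map_iff.1 hxy
    rw [hsome, hsome]
    exact Quot.sound (Multiset.mem_cons_of_mem hvw)
  · ext a b
    simp only [C, Multiset.map_cons, Network.ofEdges_cons_val, Edge.map_wire, Edge.weight_wire,
      zero_add, Edge.map_multiset_map]

theorem behaviour_eq_of_edges {V : Type} (hV : Finite V) {E E' : Multiset (Edge R V)}
    (inp : Fin m → V) (out : Fin n → V)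
    (hE : ∀ u v, Edge.wire u v ∈ E → u = v ∨ Edge.wire u v ∈ E')
    (hE' : ∀ u v, Edge.wire u v ∈ E' → Edge.wire u v ∈ E)
    (hval : ∀ {Q : Type} (π : V → Q), (∀ u v, Edge.wire u v ∈ E' → π u = π v) →
      Network.ofEdges (E.map (Edge.map π)) = Network.ofEdges (E'.map (Edge.map π))) :
    behaviour ⟨V, hV, E, inp, out⟩ = behaviour ⟨V, hV, E', inp, out⟩ := by
  refine behaviour_eq_of_map (C := ⟨V, hV, E, inp, out⟩) (D := ⟨V, hV, E', inp, out⟩) (fun v => v)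
    ((IsQuotientBy.quotMk _).congr (fun u v huv => ?_) fun u v huv => ?_)
    (hval _ fun u v huv => Quot.sound huv) (fun _ => rfl) fun _ => rfl
  · rcases hE u v huv with rfl | huv
    exacts [rfl, Quot.sound huv]
  · exact Quot.sound (hE' u v huv)

theorem SpiderRule.behaviour_eq {C D : Circuit R m n} (h : C.SpiderRule D) :
    C.behaviour = D.behaviour := by
  cases h with
  | fuse V hV u E inp out => exact behaviour_fuse hV u E inp out
  | loop V hV u E inp out =>
    refine behaviour_eq_of_edges hV inp out (fun x y hxy => ?_)
      (fun x y => Multiset.mem_cons_of_mem) fun π _ => ?_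
    · rcases Multiset.mem_cons.1 hxy with hxy | hxy
      · rcases Edge.wire_eq_wire_iff.1 hxy with ⟨rfl, rfl⟩ | ⟨rfl, rfl⟩ <;> exact .inl rfl
      · exact .inr hxy
    · ext a b
      rw [Multiset.map_cons, Network.ofEdges_cons_val, Edge.map_wire, Edge.weight_wire, zero_add]

theorem behaviour_starMesh {V : Type} (hV : Finite V) {k : ℕ} (a : Fin k → V)
    (y : Fin k → Conductance R) (E : Multiset (Edge R V)) (inp : Fin m → V) (out : Fin n → V) :
    behaviour ⟨Option V, inferInstance, starEdges none (some ∘ a) y + E.map (Edge.map some),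
        some ∘ inp, some ∘ out⟩ = behaviour ⟨V, hV, meshEdges a y + E, inp, out⟩ := by
  let C : Circuit R m n := ⟨Option V, inferInstance,
    starEdges none (some ∘ a) y + E.map (Edge.map some), some ∘ inp, some ∘ out⟩
  let D : Circuit R m n := ⟨V, hV, meshEdges a y + E, inp, out⟩
  let := Fintype.ofFinite (Quot D.Wired)
  let π := Quot.mk D.Wired
  have hwired : ∀ x y, C.Wired x y ↔ ∃ u v, D.Wired u v ∧ some u = x ∧ some v = y := by
    simp only [Wired, C, D, Multiset.mem_add, wire_notMem_starEdges, wire_notMem_meshEdges,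
      Edge.wire_mem_map_iff, false_or, implies_true]
  have hedges : C.edges.map (Edge.map (Option.map π)) =
      starEdges none (some ∘ π ∘ a) y + (E.map (Edge.map π)).map (Edge.map some) := by
    simp only [C, Multiset.map_add, map_starEdges, Edge.map_multiset_map]
    rfl
  have hedges' : D.edges.map (Edge.map π) = meshEdges (π ∘ a) y + E.map (Edge.map π) := by
    simp only [D, Multiset.map_add, map_meshEdges]
  have hterminal : Option.map π ∘ C.terminal = some ∘ π ∘ D.terminal := by
    ext1 (i | j) <;> rfl
  calc C.behaviour
    _ = (Network.ofEdges (starEdges none (some ∘ π ∘ a) y +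
          (E.map (Edge.map π)).map (Edge.map some))).behaviour (some ∘ π ∘ D.terminal) := by
      rw [C.behaviour_eq ((IsQuotientBy.quotMk D.Wired).optionMap hwired), hedges, hterminal]
    _ = (Network.ofEdges (meshEdges (π ∘ a) y + E.map (Edge.map π))).behaviour
          (π ∘ D.terminal) := by
      rw [← Network.elim_behaviour _ (x := none) (by simp)]
      exact (Network.extends_meshEdges_elim_starEdges _ y _).behaviour_eq
        (Option.some_injective _) _
    _ = D.behaviour := by rw [D.behaviour_eq (IsQuotientBy.quotMk D.Wired), hedges']

theorem ResistorRule.behaviour_eq {C D : Circuit R m n} (h : C.ResistorRule D) :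
    C.behaviour = D.behaviour := by
  cases h with
  | shortCircuit V hV u v y E inp out =>
    refine behaviour_eq_of_edges hV inp out (fun a b hab => ?_)
      (fun a b => Multiset.mem_cons_of_mem) fun π hπ => ?_
    · exact .inr ((Multiset.mem_cons.1 hab).resolve_left (Edge.wire_ne_resistor _ _ _ _ _))
    · ext a b
      rw [Multiset.map_cons, Network.ofEdges_cons_val, Edge.map_resistor,
        hπ u v (Multiset.mem_cons_self _ _), Edge.weight_resistor_self, zero_add]
  | shortCircuitLoop V hV u y E inp out =>
    refine behaviour_eq_of_edges hV inp out (fun a b hab => ?_)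
      (fun a b => Multiset.mem_cons_of_mem) fun π _ => ?_
    · exact .inr ((Multiset.mem_cons.1 hab).resolve_left (Edge.wire_ne_resistor _ _ _ _ _))
    · ext a b
      rw [Multiset.map_cons, Network.ofEdges_cons_val, Edge.map_resistor,
        Edge.weight_resistor_self, zero_add]
  | parallel V hV u v y z E inp out =>
    refine behaviour_eq_of_edges hV inp out (fun a b hab => ?_) (fun a b hab => ?_)
      fun π _ => ?_
    · simpa [Edge.wire_ne_resistor] using Or.inr hab
    · simpa [Edge.wire_ne_resistor] using hab
    · ext a b
      simp only [Multiset.map_cons, Network.ofEdges_cons_val, Edge.map_resistor,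
        Edge.weight_resistor_add, add_assoc]
  | starMesh V hV k a y E inp out => exact behaviour_starMesh hV a y E inp out

end Circuit

namespace Diagram

variable {R : Type u} [Semifield R] [PositiveRig R] {m n : ℕ}

/-- The behaviour of any circuit that represents the diagram. -/
noncomputable def behaviour (d : Diagram R m n) :
    (Fin m ⊕ Fin n → Fin m ⊕ Fin n → Prop) × (Fin m ⊕ Fin n → Fin m ⊕ Fin n → R) :=
  Quotient.lift Circuit.behaviour (fun _ _ h => Circuit.Iso.behaviour_eq h) d

theorem Step.behaviour_eq {c d : Diagram R m n} (h : Step c d) : c.behaviour = d.behaviour := by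
  obtain ⟨C, D, rfl, rfl, h | h⟩ := h
  exacts [h.behaviour_eq, h.behaviour_eq]

end Diagram

namespace Edge

variable {R : Type u} [Semifield R] {V W : Type}

/-- There are no wires, loops or parallel edges. -/
def IsSimple (E : Multiset (Edge R V)) : Prop :=
  (∀ e ∈ E, (∃ y, e.2 = Link.resistor y) ∧ ¬ e.1.IsDiag) ∧ (E.map Prod.fst).Nodup

theorem isDiag_map_iff {f : V → W} (hf : Function.Injective f) (e : Edge R V) :
    (map f e).1.IsDiag ↔ e.1.IsDiag := by
  obtain ⟨p, l⟩ := e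
  induction p using Sym2.ind with
  | _ a b => simp [map, hf.eq_iff]

namespace IsSimple

variable {E E' : Multiset (Edge R V)}

theorem map {f : V → W} (hf : Function.Injective f) (hE : IsSimple E) :
    IsSimple (E.map (Edge.map f)) := by
  refine ⟨fun e he => ?_, ?_⟩
  · obtain ⟨e', he', rfl⟩ := Multiset.mem_map.1 he
    exact ⟨(hE.1 e' he').1, (isDiag_map_iff hf e').not.2 (hE.1 e' he').2⟩
  · have h : (E.map (Edge.map f)).map Prod.fst = (E.map Prod.fst).map (Sym2.map f) := by
      rw [Multiset.map_map, Multiset.map_map]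
      rfl
    rw [h]
    exact hE.2.map (Sym2.map.injective hf)

theorem exists_eq_resistor (hE : IsSimple E) {e : Edge R V} (he : e ∈ E) :
    ∃ a b y, a ≠ b ∧ e = resistor a b y := by
  obtain ⟨⟨y, hy⟩, hd⟩ := hE.1 e he
  obtain ⟨p, l⟩ := e
  obtain rfl : l = Link.resistor y := hy
  induction p using Sym2.ind with
  | _ a b => exact ⟨a, b, y, by simpa using hd, rfl⟩

theorem wire_notMem (hE : IsSimple E) (a b : V) : wire a b ∉ E := fun h =>
  let ⟨_, _, _, _, he⟩ := hE.exists_eq_resistor h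
  wire_ne_resistor _ _ _ _ _ he

theorem val_of_resistor_mem (hE : IsSimple E) {a b : V} (hab : a ≠ b) {y : Conductance R}
    (h : resistor a b y ∈ E) : (Network.ofEdges E).val a b = y.1 := by
  obtain ⟨E, rfl⟩ := Multiset.exists_cons_of_mem h
  have hE' : (Network.ofEdges E).val a b = 0 := by
    refine Multiset.sum_eq_zero fun x hx => ?_
    obtain ⟨e, he, rfl⟩ := Multiset.mem_map.1 hx
    refine weight_of_ne fun hab' => ?_
    have hnodup := hE.2
    rw [Multiset.map_cons, Multiset.nodup_cons] at hnodup
    exact hnodup.1 (Multiset.mem_map.2 ⟨e, he, hab'⟩)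
  rw [Network.ofEdges_cons_val, hE', add_zero]
  exact weight_of_eq hab rfl

theorem resistor_mem_iff (hE : IsSimple E) {a b : V} (hab : a ≠ b) (y : Conductance R) :
    resistor a b y ∈ E ↔ (Network.ofEdges E).val a b = y.1 := by
  refine ⟨hE.val_of_resistor_mem hab, fun hy => ?_⟩
  obtain ⟨⟨p, l⟩, he, hne⟩ : ∃ e ∈ E, e.weight a b ≠ 0 := by
    by_contra! h
    refine y.2 (hy.symm.trans (Multiset.sum_eq_zero fun x hx => ?_))
    obtain ⟨e, he, rfl⟩ := Multiset.mem_map.1 hx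
    exact h e he
  obtain rfl : p = s(a, b) := by
    by_contra hp
    exact hne (weight_of_ne hp)
  obtain ⟨⟨z, hz⟩, -⟩ := hE.1 _ he
  obtain rfl : l = Link.resistor z := hz
  obtain rfl : z = y := Subtype.ext ((hE.val_of_resistor_mem hab he).symm.trans hy)
  exact he

theorem subset_of_ofEdges_val_eq (hE : IsSimple E) (hE' : IsSimple E')
    (h : ∀ a b, (Network.ofEdges E).val a b = (Network.ofEdges E').val a b) : E ⊆ E' := by
  intro e he
  obtain ⟨a, b, y, hab, rfl⟩ := hE.exists_eq_resistor he
  exact (hE'.resistor_mem_iff hab y).2 ((h a b).symm.trans (hE.val_of_resistor_mem hab he))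

theorem ext (hE : IsSimple E) (hE' : IsSimple E')
    (h : ∀ a b, (Network.ofEdges E).val a b = (Network.ofEdges E').val a b) : E = E' :=
  (Multiset.Nodup.ext (.of_map _ hE.2) (.of_map _ hE'.2)).2 fun _ =>
    ⟨fun he => hE.subset_of_ofEdges_val_eq hE' h he,
      fun he => hE'.subset_of_ofEdges_val_eq hE (fun a b => (h a b).symm) he⟩

end IsSimple

end Edge

namespace Circuit

variable {R : Type u} [Semifield R] {m n : ℕ} {C D : Circuit R m n}

theorem IsMeshFamily.isSimple (hC : C.IsMeshFamily) : Edge.IsSimple C.edges := hC.2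

theorem IsMeshFamily.terminal_surjective (hC : C.IsMeshFamily) :
    Function.Surjective C.terminal := fun v => isExternal_iff.1 (hC.1 v)

theorem Iso.isMeshFamily (h : C.Iso D) (hC : C.IsMeshFamily) : D.IsMeshFamily := by
  obtain ⟨e, he, hinp, hout⟩ := h
  refine ⟨fun v => ?_, he ▸ hC.isSimple.map e.injective⟩
  obtain ⟨v, rfl⟩ := e.surjective v
  exact (hC.1 v).imp (fun ⟨i, hi⟩ => ⟨i, hi ▸ (hinp i).symm⟩) fun ⟨j, hj⟩ => ⟨j, hj ▸ (hout j).symm⟩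

theorem IsMeshFamily.behaviour_eq [PositiveRig R] (hC : C.IsMeshFamily) :
    C.behaviour = (fun i j => C.terminal i = C.terminal j,
      fun i j => (Network.ofEdges C.edges).val (C.terminal i) (C.terminal j)) := by
  have := C.finite_node
  let := Fintype.ofFinite C.Node
  have hid : IsQuotientBy C.Wired (_root_.id : C.Node → C.Node) :=
    .of_section _root_.id (fun _ => rfl) (fun x y h => absurd h (hC.isSimple.wire_notMem x y))
      fun _ => rfl
  rw [C.behaviour_eq hid, Edge.map_multiset_id]
  exact Prod.ext rfl <| funext₂ fun i j =>
    (Network.ofEdges C.edges).response_of_surjective hC.terminal_surjective i j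

theorem IsMeshFamily.iso_of_behaviour_eq [PositiveRig R] (hC : C.IsMeshFamily)
    (hD : D.IsMeshFamily) (h : C.behaviour = D.behaviour) : C.Iso D := by
  rw [hC.behaviour_eq, hD.behaviour_eq] at h
  obtain ⟨hnodes, hval⟩ := Prod.mk.inj h
  obtain ⟨e, he⟩ := exists_equiv_of_surjective hC.terminal_surjective hD.terminal_surjective
    fun i j => iff_of_eq (congrFun₂ hnodes i j)
  refine ⟨e, (hC.isSimple.map e.injective).ext hD.isSimple fun a b => ?_, fun i => he (.inl i),
    fun j => he (.inr j)⟩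
  obtain ⟨i, rfl⟩ := hD.terminal_surjective a
  obtain ⟨j, rfl⟩ := hD.terminal_surjective b
  rw [← he, ← he, Network.ofEdges_map_val e.injective, he, he]
  exact congrFun₂ hval i j

open Classical in
/-- The number of members of `S` that are loops or occur more than once. -/
noncomputable def parallelCount {V : Type} (S : Multiset (Sym2 V)) : ℕ :=
  (S.filter fun p => p.IsDiag ∨ 2 ≤ S.count p).card

theorem numParallel_eq (C : Circuit R m n) :
    C.numParallel = parallelCount (C.edges.map Prod.fst) := by
  rw [numParallel, parallelCount, Multiset.filter_map, Multiset.card_map]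
  rfl

theorem parallelCount_lt_cons {V : Type} {S : Multiset (Sym2 V)} {p : Sym2 V}
    (hp : p.IsDiag ∨ p ∈ S) : parallelCount S < parallelCount (p ::ₘ S) := by
  classical
  rw [parallelCount, parallelCount, Multiset.filter_cons_of_pos, Multiset.card_cons,
    Nat.lt_succ_iff]
  · exact Multiset.card_le_card <| Multiset.monotone_filter_right _ fun q hq =>
      hq.imp_right fun hq => hq.trans (Multiset.count_le_count_cons _ _ _)
  · refine hp.imp_right fun hp => ?_
    rw [Multiset.count_cons_self]
    exact Nat.succ_le_succ (Multiset.one_le_count_iff_mem.2 hp)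

theorem toLex_lt_of_numNodes_eq_add_one (h : C.numNodes = D.numNodes + 1) :
    toLex (D.numNodes, D.numParallel) < toLex (C.numNodes, C.numParallel) :=
  Prod.Lex.toLex_lt_toLex.2 (.inl (h ▸ Nat.lt_succ_self _))

theorem toLex_lt_of_cons {V : Type} (hV : Finite V) {E E' : Multiset (Edge R V)} {p : Sym2 V}
    (hE : E'.map Prod.fst = p ::ₘ E.map Prod.fst) (hp : p.IsDiag ∨ p ∈ E.map Prod.fst)
    (inp : Fin m → V) (out : Fin n → V) :
    toLex (numNodes ⟨V, hV, E, inp, out⟩, numParallel ⟨V, hV, E, inp, out⟩) <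
      toLex (numNodes ⟨V, hV, E', inp, out⟩, numParallel ⟨V, hV, E', inp, out⟩) := by
  refine Prod.Lex.toLex_lt_toLex.2 (.inr ⟨rfl, ?_⟩)
  rw [numParallel_eq, numParallel_eq]
  exact hE ▸ parallelCount_lt_cons hp

theorem SpiderRule.toLex_lt (h : C.SpiderRule D) :
    toLex (D.numNodes, D.numParallel) < toLex (C.numNodes, C.numParallel) := by
  cases h with
  | fuse V hV u E inp out =>
    exact toLex_lt_of_numNodes_eq_add_one Finite.card_option
  | loop V hV u E inp out =>
    exact toLex_lt_of_cons hV (p := s(u, u)) (by simp [Edge.wire]) (by simp) inp out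

theorem ResistorRule.toLex_lt [PositiveRig R] (h : C.ResistorRule D) :
    toLex (D.numNodes, D.numParallel) < toLex (C.numNodes, C.numParallel) := by
  cases h with
  | shortCircuit V hV u v y E inp out =>
    exact toLex_lt_of_cons hV (p := s(u, v)) (by simp [Edge.wire, Edge.resistor])
      (by simp [Edge.wire]) inp out
  | shortCircuitLoop V hV u y E inp out =>
    exact toLex_lt_of_cons hV (p := s(u, u)) (by simp [Edge.resistor]) (by simp) inp out
  | parallel V hV u v y z E inp out =>
    exact toLex_lt_of_cons hV (p := s(u, v)) (by simp [Edge.resistor])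
      (by simp [Edge.resistor]) inp out
  | starMesh V hV k a y E inp out =>
    exact toLex_lt_of_numNodes_eq_add_one Finite.card_option

theorem IsMeshFamily.not_spiderRule (hC : C.IsMeshFamily) : ¬ C.SpiderRule D := by
  rintro (⟨V, hV, u, E, inp, out⟩ | ⟨V, hV, u, E, inp, out⟩)
  all_goals exact hC.isSimple.wire_notMem _ _ (Multiset.mem_cons_self _ _)

theorem IsMeshFamily.not_resistorRule [PositiveRig R] (hC : C.IsMeshFamily) :
    ¬ C.ResistorRule D := by
  intro h
  cases h with
  | shortCircuit V hV u v y E inp out =>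
    exact hC.isSimple.wire_notMem u v (Multiset.mem_cons_of_mem (Multiset.mem_cons_self _ _))
  | shortCircuitLoop V hV u y E inp out =>
    exact (hC.2.1 _ (Multiset.mem_cons_self _ _)).2 rfl
  | parallel V hV u v y z E inp out => simpa [Edge.resistor] using hC.2.2
  | starMesh V hV k a y E inp out => simpa [IsExternal] using hC.1 none

variable {V : Type}

theorem starEdges_cons {k : ℕ} (x : V) (v : V) (a : Fin k → V) (y : Conductance R)
    (z : Fin k → Conductance R) :
    starEdges x (Fin.cons v a : Fin (k + 1) → V) (Fin.cons y z : Fin (k + 1) → Conductance R) =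
      Edge.resistor x v y ::ₘ starEdges x a z := by
  simp [starEdges, Fin.univ_val_map, List.ofFn_succ]

theorem exists_eq_starEdges_add (E : Multiset (Edge R (Option V)))
    (hE : ∀ e ∈ E, (∃ y, e.2 = Link.resistor y) ∧ ¬ e.1.IsDiag) :
    ∃ (k : ℕ) (a : Fin k → V) (y : Fin k → Conductance R) (E' : Multiset (Edge R V)),
      E = starEdges none (some ∘ a) y + E'.map (Edge.map some) := by
  induction E using Multiset.induction with
  | empty => exact ⟨0, Fin.elim0, Fin.elim0, 0, rfl⟩
  | cons e E ih =>
    obtain ⟨k, a, y, E', rfl⟩ := ih fun e he => hE e (Multiset.mem_cons_of_mem he)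
    obtain ⟨⟨z, hz⟩, hd⟩ := hE e (Multiset.mem_cons_self _ _)
    obtain ⟨p, l⟩ := e
    obtain rfl : l = Link.resistor z := hz
    have cons_arm : ∀ v : V, (s(none, some v), Link.resistor z) ::ₘ
        (starEdges none (some ∘ a) y + E'.map (Edge.map some)) =
        starEdges none (some ∘ (Fin.cons v a : Fin (k + 1) → V)) (Fin.cons z y) +
          E'.map (Edge.map some) := fun v => by
      rw [Fin.comp_cons, starEdges_cons, Multiset.cons_add]
      rfl
    induction p using Sym2.ind with
    | _ u v =>
      rcases u with _ | u <;> rcases v with _ | v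
      · exact absurd rfl hd
      · exact ⟨k + 1, Fin.cons v a, Fin.cons z y, E', cons_arm v⟩
      · exact ⟨k + 1, Fin.cons u a, Fin.cons z y, E', Sym2.eq_swap (a := none) ▸ cons_arm u⟩
      · refine ⟨k, a, y, Edge.resistor u v z ::ₘ E', ?_⟩
        rw [Multiset.map_cons, Multiset.add_cons]
        rfl

end Circuit

namespace Diagram

variable {R : Type u} [Semifield R] [PositiveRig R] {m n : ℕ}

theorem SpiderStep.step {c d : Diagram R m n} (h : SpiderStep c d) : Step c d :=
  let ⟨C, D, hC, hD, hCD⟩ := h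
  ⟨C, D, hC, hD, .inl hCD⟩

theorem steps_of_spiderSteps {c d : Diagram R m n} (h : ReflTransGen SpiderStep c d) :
    ReflTransGen Step c d :=
  ReflTransGen.mono (fun _ _ => SpiderStep.step) _ _ h

theorem Step.toLex_lt {c d : Diagram R m n} (h : Step c d) :
    toLex (d.numNodes, d.numParallel) < toLex (c.numNodes, c.numParallel) := by
  obtain ⟨C, D, rfl, rfl, h | h⟩ := h
  exacts [h.toLex_lt, h.toLex_lt]

theorem terminating_step : Rewriting.Terminating (Step (R := R) (m := m) (n := n)) :=
  Subrelation.wf Step.toLex_lt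
    (InvImage.wf (fun d : Diagram R m n => toLex (d.numNodes, d.numParallel)) wellFounded_lt)

end Diagram

namespace Circuit

open Rewriting (IsNormal)

variable {R : Type u} [Semifield R] [PositiveRig R] {m n : ℕ} {C : Circuit R m n}

theorem wire_notMem_of_isNormal (hC : IsNormal Diagram.Step (Diagram.mk C)) (a b : C.Node) :
    Edge.wire a b ∉ C.edges := by
  obtain ⟨V, hV, E, inp, out⟩ := C
  change V at a b
  intro (h : Edge.wire a b ∈ E)
  obtain ⟨E, rfl⟩ := Multiset.exists_cons_of_mem h
  by_cases hab : b = a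
  · subst hab
    exact hC _ ⟨_, _, rfl, rfl, .inl (.loop V hV b E inp out)⟩
  · exact hC _ (spiderStep_collapse hV hab E inp out).step

theorem resistor_self_notMem_of_isNormal (hC : IsNormal Diagram.Step (Diagram.mk C)) (a : C.Node)
    (y : Conductance R) : Edge.resistor a a y ∉ C.edges := by
  obtain ⟨V, hV, E, inp, out⟩ := C
  change V at a
  intro (h : Edge.resistor a a y ∈ E)
  obtain ⟨E, rfl⟩ := Multiset.exists_cons_of_mem h
  exact hC _ ⟨_, _, rfl, rfl, .inr (.shortCircuitLoop V hV a y E inp out)⟩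

theorem resistor_of_isNormal (hC : IsNormal Diagram.Step (Diagram.mk C)) {e : Edge R C.Node}
    (he : e ∈ C.edges) : (∃ y, e.2 = Link.resistor y) ∧ ¬ e.1.IsDiag := by
  obtain ⟨p, l⟩ := e
  induction p using Sym2.ind with
  | _ a b =>
    cases l with
    | wire => exact absurd he (wire_notMem_of_isNormal hC a b)
    | resistor y =>
      refine ⟨⟨y, rfl⟩, fun hd => ?_⟩
      obtain rfl : a = b := hd
      exact resistor_self_notMem_of_isNormal hC a y he

theorem nodup_of_isNormal (hC : IsNormal Diagram.Step (Diagram.mk C)) :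
    (C.edges.map Prod.fst).Nodup := by
  classical
  refine Multiset.nodup_iff_ne_cons_cons.2 fun p S hS => ?_
  have hres := fun e => resistor_of_isNormal hC (e := e)
  obtain ⟨V, hV, E, inp, out⟩ := C
  obtain ⟨⟨p, l⟩, he, rfl, hS⟩ := (Multiset.map_eq_cons Prod.fst E _ _).2 hS
  obtain ⟨⟨q, l'⟩, he', hq, -⟩ := (Multiset.map_eq_cons Prod.fst _ _ _).2 hS
  obtain ⟨⟨y, hy⟩, -⟩ := hres _ he
  obtain ⟨⟨z, hz⟩, -⟩ := hres _ (Multiset.mem_of_mem_erase he')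
  obtain ⟨rfl, rfl, rfl⟩ : l = Link.resistor y ∧ l' = Link.resistor z ∧ q = p := ⟨hy, hz, hq⟩
  obtain ⟨E', hE'⟩ := Multiset.exists_cons_of_mem he'
  obtain rfl : E = _ ::ₘ _ ::ₘ E' := by rw [← hE', Multiset.cons_erase he]
  induction q using Sym2.ind with
  | _ u v => exact hC _ ⟨_, _, rfl, rfl, .inr (.parallel V hV u v y z E' inp out)⟩

theorem isExternal_of_isNormal (hC : IsNormal Diagram.Step (Diagram.mk C)) (x : C.Node) :
    C.IsExternal x := by
  classical
  by_contra hx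
  have := C.finite_node
  let e := (Equiv.optionSubtypeNe x).symm
  obtain ⟨k, a, y, E, hE⟩ := exists_eq_starEdges_add (C.edges.map (Edge.map e)) fun e' he' => by
    obtain ⟨e₀, he₀, rfl⟩ := Multiset.mem_map.1 he'
    have h := resistor_of_isNormal hC he₀
    exact ⟨h.1, (Edge.isDiag_map_iff e.injective e₀).not.2 h.2⟩
  have hinp : ∀ i, C.inp i ≠ x := fun i hi => hx (.inl ⟨i, hi⟩)
  have hout : ∀ j, C.out j ≠ x := fun j hj => hx (.inr ⟨j, hj⟩)
  refine hC _ ⟨_, _, Diagram.mk_eq_mk_iff.2 ⟨e, hE, fun i => ?_, fun j => ?_⟩, rfl,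
    .inr (.starMesh _ inferInstance k a y E (fun i => ⟨C.inp i, hinp i⟩)
      fun j => ⟨C.out j, hout j⟩)⟩
  · exact Equiv.optionSubtypeNe_symm_of_ne (hinp i)
  · exact Equiv.optionSubtypeNe_symm_of_ne (hout j)

end Circuit

namespace Diagram

variable {R : Type u} [Semifield R] [PositiveRig R] {m n : ℕ}

theorem isNormal_step_iff (d : Diagram R m n) :
    Rewriting.IsNormal Step d ↔ d.IsMeshFamily := by
  constructor
  · intro h
    induction d using Quotient.inductionOn with
    | _ C => exact ⟨C, rfl, Circuit.isExternal_of_isNormal h,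
        fun _ => Circuit.resistor_of_isNormal h, Circuit.nodup_of_isNormal h⟩
  · rintro ⟨C, rfl, hC⟩ d ⟨C', D, hCC', -, h⟩
    have hC' := (mk_eq_mk_iff.1 hCC').isMeshFamily hC
    exact h.elim hC'.not_spiderRule hC'.not_resistorRule

theorem injOn_behaviour :
    {d : Diagram R m n | Rewriting.IsNormal Step d}.InjOn behaviour := by
  intro c hc d hd h
  obtain ⟨C, rfl, hC⟩ := (isNormal_step_iff c).1 hc
  obtain ⟨D, rfl, hD⟩ := (isNormal_step_iff d).1 hd
  exact mk_eq_mk_iff.2 (hC.iso_of_behaviour_eq hD h)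

theorem confluent_step : Rewriting.Confluent (Step (R := R) (m := m) (n := n)) :=
  terminating_step.confluent_of_invariant (fun _ _ h => h.behaviour_eq) injOn_behaviour

end Diagram

/-- A circuit with `m'` inputs and `n'` outputs with a hole for a circuit with `m` inputs and `n`
outputs.  The elements of `Fin m ⊕ Fin n` are the ends of the hole; they are not nodes themselves,
but stand for the nodes to which the circuit in the hole attaches its inputs and outputs. -/
structure Context (R : Type u) [Semifield R] (m n m' n' : ℕ) where
  Node : Type
  finite_node : Finite Node
  edges : Multiset (Edge R ((Fin m ⊕ Fin n) ⊕ Node))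
  inp : Fin m' → (Fin m ⊕ Fin n) ⊕ Node
  out : Fin n' → (Fin m ⊕ Fin n) ⊕ Node

namespace Context

variable {R : Type u} [Semifield R] {m n m' n' : ℕ}

/-- The node of the filled context that belongs to a node of the context or an end of its hole. -/
def place (K : Context R m n m' n') {V : Type} (inp : Fin m → V) (out : Fin n → V) :
    (Fin m ⊕ Fin n) ⊕ K.Node → V ⊕ K.Node :=
  Sum.map (Sum.elim inp out) id

theorem map_comp_place (K : Context R m n m' n') {V W : Type} (f : V → W) (inp : Fin m → V)
    (out : Fin n → V) : Sum.map f id ∘ K.place inp out = K.place (f ∘ inp) (f ∘ out) := by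
  rw [place, place, Sum.map_comp_map, Sum.comp_elim, Function.id_comp]

/-- The circuit obtained by filling the hole of a context. -/
def plug (K : Context R m n m' n') (C : Circuit R m n) : Circuit R m' n' where
  Node := C.Node ⊕ K.Node
  finite_node := by
    have := C.finite_node
    have := K.finite_node
    infer_instance
  edges := C.edges.map (Edge.map Sum.inl) + K.edges.map (Edge.map (K.place C.inp C.out))
  inp := K.place C.inp C.out ∘ K.inp
  out := K.place C.inp C.out ∘ K.out

variable (K : Context R m n m' n')

theorem isQuotientBy_map_getD {V W : Type} (u : V) :
    IsQuotientBy (fun x y => (x, y) ∈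
        ({(Sum.inl none, Sum.inl (some u))} : Multiset ((Option V ⊕ W) × (Option V ⊕ W))))
      (Sum.map (fun v => v.getD u) id) := by
  refine .of_section (Sum.map some id) ?_ ?_ ?_
  · rintro (v | w) <;> rfl
  · intro x y h
    obtain ⟨rfl, rfl⟩ := Prod.mk.inj (Multiset.mem_singleton.1 h)
    rfl
  · rintro ((_ | v) | w)
    · exact (Quot.sound (Multiset.mem_singleton_self _)).symm
    · rfl
    · rfl

theorem spiderSteps_plug {C D : Circuit R m n} (h : C.SpiderRule D) :
    ReflTransGen Diagram.SpiderStep (Diagram.mk (K.plug C)) (Diagram.mk (K.plug D)) := by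
  have hK := K.finite_node
  cases h with
  | fuse V hV u E inp out =>
    have hplace := K.map_comp_place (fun v => v.getD u) inp out
    refine Circuit.spiderSteps_of_isQuotientBy {(Sum.inl none, Sum.inl (some u))}
      (E := E.map (Edge.map Sum.inl) + K.edges.map (Edge.map (K.place inp out)))
      ?_ (isQuotientBy_map_getD u) ?_ (fun i => (congrFun hplace (K.inp i)).symm)
      fun j => (congrFun hplace (K.out j)).symm
    · simp only [plug, Multiset.map_cons, Edge.map_wire, Multiset.cons_add]
      rfl
    · simp only [plug, Multiset.map_add, Edge.map_multiset_map]
      rw [hplace]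
      rfl
  | loop V hV u E inp out =>
    refine .single ⟨_, _, ?_, rfl, .loop (V ⊕ K.Node) inferInstance (Sum.inl u) _ _ _⟩
    simp only [plug, Multiset.map_cons, Edge.map_wire, Multiset.cons_add]

/-- The bijection which makes the adjoined point of `Option V` that of `Option (V ⊕ W)`. -/
def optionSum (V W : Type) : Option V ⊕ W ≃ Option (V ⊕ W) where
  toFun := Sum.elim (Option.map Sum.inl) (some ∘ Sum.inr)
  invFun x := x.elim (Sum.inl none) (Sum.map some id)
  left_inv := by rintro ((_ | v) | w) <;> rfl
  right_inv := by rintro (_ | (v | w)) <;> rfl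

theorem optionSum_place {V : Type} (inp : Fin m → V) (out : Fin n → V)
    (x : (Fin m ⊕ Fin n) ⊕ K.Node) :
    optionSum V K.Node (K.place (fun i => some (inp i)) (fun j => some (out j)) x) =
      some (K.place inp out x) := by
  rcases x with (i | j) | x <;> rfl

theorem step_plug [PositiveRig R] {C D : Circuit R m n} (h : C.ResistorRule D) :
    (Diagram.mk (K.plug C)).Step (Diagram.mk (K.plug D)) := by
  have hK := K.finite_node
  cases h with
  | shortCircuit V hV u v y E inp out =>
    refine ⟨_, _, ?_, ?_, .inr (.shortCircuit (V ⊕ K.Node) inferInstance (.inl u) (.inl v) y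
      (E.map (Edge.map Sum.inl) + K.edges.map (Edge.map (K.place inp out)))
      (K.place inp out ∘ K.inp) (K.place inp out ∘ K.out))⟩ <;>
    simp only [plug, Multiset.map_cons, Multiset.cons_add, Edge.map_wire, Edge.map_resistor]
  | shortCircuitLoop V hV u y E inp out =>
    refine ⟨_, _, ?_, rfl, .inr (.shortCircuitLoop (V ⊕ K.Node) inferInstance (.inl u) y _ _ _)⟩
    simp only [plug, Multiset.map_cons, Multiset.cons_add, Edge.map_resistor]
  | parallel V hV u v y z E inp out =>
    refine ⟨_, _, ?_, ?_, .inr (.parallel (V ⊕ K.Node) inferInstance (.inl u) (.inl v) y z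
      (E.map (Edge.map Sum.inl) + K.edges.map (Edge.map (K.place inp out)))
      (K.place inp out ∘ K.inp) (K.place inp out ∘ K.out))⟩ <;>
    simp only [plug, Multiset.map_cons, Multiset.cons_add, Edge.map_resistor]
  | starMesh V hV k a y E inp out =>
    have hplace := K.optionSum_place inp out
    refine ⟨_, _, ?_, ?_, .inr (.starMesh (V ⊕ K.Node) inferInstance k (fun i => .inl (a i)) y
      (E.map (Edge.map Sum.inl) + K.edges.map (Edge.map (K.place inp out)))
      (K.place inp out ∘ K.inp) (K.place inp out ∘ K.out))⟩
    · refine Diagram.mk_eq_mk_iff.2 ⟨optionSum V K.Node, ?_, fun _ => hplace _, fun _ => hplace _⟩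
      simp only [plug, Multiset.map_add, Multiset.map_map, Function.comp_def, Edge.map_map,
        Edge.map_resistor, add_assoc]
      rw [← funext hplace]
      rfl
    · simp only [plug, Multiset.map_add, Multiset.map_map, Function.comp_def, Circuit.meshEdges,
        Edge.map_resistor, add_assoc]

/-- The context `- ≫ D`. -/
def compRight (D : Circuit R n n') : Context R m n m n' where
  Node := D.Node
  finite_node := D.finite_node
  edges := D.edges.map (Edge.map Sum.inr) + (Finset.univ : Finset (Fin n)).val.map
    fun j => Edge.wire (Sum.inl (Sum.inr j)) (Sum.inr (D.inp j))
  inp i := Sum.inl (Sum.inl i)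
  out j := Sum.inr (D.out j)

theorem iso_compRight_plug (D : Circuit R n n') (C : Circuit R m n) :
    (C.comp D).Iso ((compRight D).plug C) := by
  refine ⟨Equiv.refl _, ?_, fun _ => rfl, fun _ => rfl⟩
  simp only [Circuit.comp, plug, compRight, place, Multiset.map_add, Multiset.map_map,
    Function.comp_def, Edge.map_map, Edge.map_wire, add_assoc]
  rfl

/-- The context `D ≫ -`. -/
def compLeft (D : Circuit R m' m) : Context R m n m' n where
  Node := D.Node
  finite_node := D.finite_node
  edges := D.edges.map (Edge.map Sum.inr) + (Finset.univ : Finset (Fin m)).val.map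
    fun j => Edge.wire (Sum.inr (D.out j)) (Sum.inl (Sum.inl j))
  inp i := Sum.inr (D.inp i)
  out j := Sum.inl (Sum.inr j)

theorem iso_compLeft_plug (D : Circuit R m' m) (C : Circuit R m n) :
    (D.comp C).Iso ((compLeft D).plug C) := by
  refine ⟨Equiv.sumComm _ _, ?_, fun _ => rfl, fun _ => rfl⟩
  simp only [Circuit.comp, plug, compLeft, place, Multiset.map_add, Multiset.map_map,
    Function.comp_def, Edge.map_map, Edge.map_wire]
  rw [← add_assoc, add_comm (Multiset.map _ D.edges)]
  rfl

/-- The context `- ⊗ D`. -/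
def tensorRight (D : Circuit R m' n') : Context R m n (m + m') (n + n') where
  Node := D.Node
  finite_node := D.finite_node
  edges := D.edges.map (Edge.map Sum.inr)
  inp := Fin.append (fun i => Sum.inl (Sum.inl i)) (fun i => Sum.inr (D.inp i))
  out := Fin.append (fun j => Sum.inl (Sum.inr j)) (fun j => Sum.inr (D.out j))

theorem iso_tensorRight_plug (D : Circuit R m' n') (C : Circuit R m n) :
    (C.tensor D).Iso ((tensorRight D).plug C) := by
  refine ⟨Equiv.refl _, ?_, fun i => ?_, fun j => ?_⟩
  · simp only [Circuit.tensor, plug, tensorRight, Multiset.map_add, Multiset.map_map,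
      Function.comp_def, Edge.map_map]
    rfl
  · cases i using Fin.addCases <;>
      (simp only [Circuit.tensor, plug, tensorRight, Function.comp_apply, Fin.append_left,
        Fin.append_right]
       rfl)
  · cases j using Fin.addCases <;>
      (simp only [Circuit.tensor, plug, tensorRight, Function.comp_apply, Fin.append_left,
        Fin.append_right]
       rfl)

/-- The context `D ⊗ -`. -/
def tensorLeft (D : Circuit R m' n') : Context R m n (m' + m) (n' + n) where
  Node := D.Node
  finite_node := D.finite_node
  edges := D.edges.map (Edge.map Sum.inr)
  inp := Fin.append (fun i => Sum.inr (D.inp i)) (fun i => Sum.inl (Sum.inl i))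
  out := Fin.append (fun j => Sum.inr (D.out j)) (fun j => Sum.inl (Sum.inr j))

theorem iso_tensorLeft_plug (D : Circuit R m' n') (C : Circuit R m n) :
    (D.tensor C).Iso ((tensorLeft D).plug C) := by
  refine ⟨Equiv.sumComm _ _, ?_, fun i => ?_, fun j => ?_⟩
  · simp only [Circuit.tensor, plug, tensorLeft, Multiset.map_add, Multiset.map_map,
      Function.comp_def, Edge.map_map]
    rw [add_comm]
    rfl
  · cases i using Fin.addCases <;>
      (simp only [Circuit.tensor, plug, tensorLeft, Function.comp_apply, Fin.append_left,
        Fin.append_right]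
       rfl)
  · cases j using Fin.addCases <;>
      (simp only [Circuit.tensor, plug, tensorLeft, Function.comp_apply, Fin.append_left,
        Fin.append_right]
       rfl)

end Context

namespace Diagram

variable {R : Type u} [Semifield R] [PositiveRig R] {m n k m' n' : ℕ}

theorem steps_of_context (K : Context R m n m' n') {op : Diagram R m n → Diagram R m' n'}
    (hop : ∀ C, op (mk C) = mk (K.plug C)) {c d : Diagram R m n} (h : ReflTransGen Step c d) :
    ReflTransGen Step (op c) (op d) := by
  induction h with
  | refl => exact .refl
  | tail _ h ih =>
    obtain ⟨C, D, rfl, rfl, h⟩ := h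
    rw [hop] at ih ⊢
    exact ih.trans (h.elim (fun h => steps_of_spiderSteps (K.spiderSteps_plug h))
      fun h => .single (K.step_plug h))

theorem steps_comp {c c' : Diagram R m k} {d d' : Diagram R k n} (hc : ReflTransGen Step c c')
    (hd : ReflTransGen Step d d') : ReflTransGen Step (c.comp d) (c'.comp d') := by
  have hcd : ReflTransGen Step (c.comp d) (c'.comp d) := by
    induction d using Quotient.inductionOn with
    | _ D => exact steps_of_context _ (fun C => mk_eq_mk_iff.2 (Context.iso_compRight_plug D C)) hc
  refine hcd.trans ?_
  induction c' using Quotient.inductionOn with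
  | _ C => exact steps_of_context _ (fun D => mk_eq_mk_iff.2 (Context.iso_compLeft_plug C D)) hd

theorem steps_tensor {c c' : Diagram R m n} {d d' : Diagram R m' n'}
    (hc : ReflTransGen Step c c') (hd : ReflTransGen Step d d') :
    ReflTransGen Step (c.tensor d) (c'.tensor d') := by
  have hcd : ReflTransGen Step (c.tensor d) (c'.tensor d) := by
    induction d using Quotient.inductionOn with
    | _ D =>
      exact steps_of_context _ (fun C => mk_eq_mk_iff.2 (Context.iso_tensorRight_plug D C)) hc
  refine hcd.trans ?_
  induction c' using Quotient.inductionOn with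
  | _ C => exact steps_of_context _ (fun D => mk_eq_mk_iff.2 (Context.iso_tensorLeft_plug C D)) hd

end Diagram

namespace Circuit

variable {R : Type u} [Semifield R] {m n k l : ℕ}

theorem spiderSteps_id_comp (C : Circuit R m n) :
    ReflTransGen Diagram.SpiderStep (Diagram.mk ((id R m).comp C)) (Diagram.mk C) := by
  refine spiderSteps_of_isQuotientBy (C := (id R m).comp C) (π := Sum.elim C.inp _root_.id)
    ((Finset.univ : Finset (Fin m)).val.map fun j => (Sum.inl j, Sum.inr (C.inp j)))
    (E := C.edges.map (Edge.map Sum.inr)) ?_ (.of_section Sum.inr (fun _ => rfl) ?_ ?_) ?_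
    (fun _ => rfl) fun _ => rfl
  · simp only [comp, id, Multiset.map_zero, zero_add, Multiset.map_map, Function.comp_def]
    exact add_comm _ _
  · intro x y h
    obtain ⟨j, -, hj⟩ := Multiset.mem_map.1 h
    obtain ⟨rfl, rfl⟩ := Prod.mk.inj hj
    rfl
  · rintro (j | v)
    · exact (Quot.sound (Multiset.mem_map_of_mem _ (Finset.mem_univ (α := Fin m) j))).symm
    · rfl
  · exact ((Edge.map_multiset_map (Sum.elim C.inp _root_.id) Sum.inr C.edges).trans
      (Edge.map_multiset_id C.edges)).symm

theorem spiderSteps_comp_id (C : Circuit R m n) :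
    ReflTransGen Diagram.SpiderStep (Diagram.mk (C.comp (id R n))) (Diagram.mk C) := by
  refine spiderSteps_of_isQuotientBy (C := C.comp (id R n)) (π := Sum.elim _root_.id C.out)
    ((Finset.univ : Finset (Fin n)).val.map fun j => (Sum.inl (C.out j), Sum.inr j))
    (E := C.edges.map (Edge.map Sum.inl)) ?_ (.of_section Sum.inl (fun _ => rfl) ?_ ?_) ?_
    (fun _ => rfl) fun _ => rfl
  · simp only [comp, id, Multiset.map_zero, add_zero, Multiset.map_map, Function.comp_def]
    exact add_comm _ _
  · intro x y h
    obtain ⟨j, -, hj⟩ := Multiset.mem_map.1 h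
    obtain ⟨rfl, rfl⟩ := Prod.mk.inj hj
    rfl
  · rintro (v | j)
    · rfl
    · exact Quot.sound (Multiset.mem_map_of_mem _ (Finset.mem_univ (α := Fin n) j))
  · exact ((Edge.map_multiset_map (Sum.elim _root_.id C.out) Sum.inl C.edges).trans
      (Edge.map_multiset_id C.edges)).symm

/-- The pairs of nodes that are joined by the new wires of a composite of three circuits. -/
inductive CompWire (A : Circuit R m k) (B : Circuit R k l) (D : Circuit R l n) :
    A.Node ⊕ (B.Node ⊕ D.Node) → A.Node ⊕ (B.Node ⊕ D.Node) → Prop where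
  | left (j : Fin k) : CompWire A B D (.inl (A.out j)) (.inr (.inl (B.inp j)))
  | right (j : Fin l) : CompWire A B D (.inr (.inl (B.out j))) (.inr (.inr (D.inp j)))

theorem spiderSteps_comp_comp (A : Circuit R m k) (B : Circuit R k l) (D : Circuit R l n)
    (T : Circuit R m n) {π : A.Node ⊕ (B.Node ⊕ D.Node) → T.Node}
    (hπ : IsQuotientBy (CompWire A B D) π)
    (hedges : T.edges = A.edges.map (Edge.map (π ∘ Sum.inl)) +
      B.edges.map (Edge.map (π ∘ Sum.inr ∘ Sum.inl)) +
      D.edges.map (Edge.map (π ∘ Sum.inr ∘ Sum.inr)))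
    (hinp : ∀ i, T.inp i = π (.inl (A.inp i))) (hout : ∀ j, T.out j = π (.inr (.inr (D.out j)))) :
    ReflTransGen Diagram.SpiderStep (Diagram.mk (A.comp (B.comp D))) (Diagram.mk T) := by
  refine spiderSteps_of_isQuotientBy (C := A.comp (B.comp D))
    (((Finset.univ : Finset (Fin k)).val.map fun j =>
        (Sum.inl (A.out j), Sum.inr (Sum.inl (B.inp j)))) +
      (Finset.univ : Finset (Fin l)).val.map fun j =>
        (Sum.inr (Sum.inl (B.out j)), Sum.inr (Sum.inr (D.inp j))))
    (E := A.edges.map (Edge.map Sum.inl) + B.edges.map (Edge.map (Sum.inr ∘ Sum.inl)) +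
      D.edges.map (Edge.map (Sum.inr ∘ Sum.inr)))
    ?_ (hπ.congr (fun x y h => ?_) fun x y h => ?_) ?_ hinp hout
  · simp only [comp, Multiset.map_add, Multiset.map_map, Function.comp_def, Edge.map_map,
      Edge.map_wire]
    generalize A.edges.map _ = a, B.edges.map _ = b, D.edges.map _ = d,
      Multiset.map _ (Finset.univ : Finset (Fin k)).val = w,
      Multiset.map _ (Finset.univ : Finset (Fin l)).val = w'
    abel
  · rcases Multiset.mem_add.1 h with h | h
    all_goals
      obtain ⟨j, -, hj⟩ := Multiset.mem_map.1 h
      obtain ⟨rfl, rfl⟩ := Prod.mk.inj hj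
    exacts [Quot.sound (.left j), Quot.sound (.right j)]
  · cases h with
    | left j =>
      exact Quot.sound (Multiset.mem_add.2 (.inl (Multiset.mem_map_of_mem _ (Finset.mem_univ j))))
    | right j =>
      exact Quot.sound (Multiset.mem_add.2 (.inr (Multiset.mem_map_of_mem _ (Finset.mem_univ j))))
  · change _ = Multiset.map (Edge.map π)
      (_ + _ + _ : Multiset (Edge R (A.Node ⊕ (B.Node ⊕ D.Node))))
    rw [Multiset.map_add, Multiset.map_add, Edge.map_multiset_map, Edge.map_multiset_map,
      Edge.map_multiset_map]
    exact hedges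

theorem isQuotientBy_selfAdjoint (y : Conductance R) :
    IsQuotientBy (CompWire (m := 1) (k := 3) (l := 3) (n := 1) ((id R 1).tensor (junction R 0 2))
        (((id R 1).tensor (conductance y)).tensor (id R 1)) ((junction R 2 0).tensor (id R 1)))
      (Sum.elim (Sum.elim (fun _ => false) (fun _ => true))
        (Sum.elim (Sum.elim (Sum.elim (fun _ => false) (fun b => !b)) (fun _ => true))
          (Sum.elim (fun _ => false) (fun _ => true)))) := by
  have left (j : Fin 3) := Quot.sound (CompWire.left (A := (id R 1).tensor (junction R 0 2))
    (B := ((id R 1).tensor (conductance y)).tensor (id R 1))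
    (D := (junction R 2 0).tensor (id R 1)) j)
  have right (j : Fin 3) := Quot.sound (CompWire.right (A := (id R 1).tensor (junction R 0 2))
    (B := ((id R 1).tensor (conductance y)).tensor (id R 1))
    (D := (junction R 2 0).tensor (id R 1)) j)
  refine .of_section
    (fun b : Bool => if b then Sum.inl (Sum.inr ()) else Sum.inl (Sum.inl (0 : Fin 1))) ?_ ?_ ?_
  · rintro (_ | _) <;> rfl
  · rintro _ _ (j | j) <;> fin_cases j <;> rfl
  · rintro ((x | x) | ((x | x) | x) | (x | x))
    · obtain rfl : x = (0 : Fin 1) := Subsingleton.elim (α := Fin 1) _ _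
      rfl
    · rfl
    · obtain rfl : x = (0 : Fin 1) := Subsingleton.elim (α := Fin 1) _ _
      exact left 0
    · cases x
      · exact left 1
      · exact (left 0).trans ((right 0).trans (right 1).symm)
    · obtain rfl : x = (0 : Fin 1) := Subsingleton.elim (α := Fin 1) _ _
      exact left 2
    · exact (left 0).trans (right 0)
    · obtain rfl : x = (0 : Fin 1) := Subsingleton.elim (α := Fin 1) _ _
      exact (left 2).trans (right 2)

theorem spiderSteps_selfAdjoint (y : Conductance R) :
    ReflTransGen Diagram.SpiderStep
      (Diagram.mk (m := 1) (n := 1) (((id R 1).tensor (junction R 0 2)).comp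
          ((((id R 1).tensor (conductance y)).tensor (id R 1)).comp
            ((junction R 2 0).tensor (id R 1)))))
      (Diagram.mk (conductance y)) := by
  refine spiderSteps_comp_comp _ _ _ _ (isQuotientBy_selfAdjoint y) ?_ (fun i => ?_) fun j => ?_
  · simp only [tensor, id, junction, conductance, Multiset.map_zero, add_zero, zero_add,
      Multiset.map_singleton, Edge.map_resistor, Function.comp_apply, Sum.elim_inl, Sum.elim_inr,
      Bool.not_false, Bool.not_true]
    rw [Edge.resistor_comm]
    exact ((add_zero _).trans (zero_add _)).symm
  · obtain rfl : i = (0 : Fin 1) := Subsingleton.elim (α := Fin 1) _ _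
    rfl
  · obtain rfl : j = (0 : Fin 1) := Subsingleton.elim (α := Fin 1) _ _
    rfl

/-- Two resistors in parallel, as a circuit from `1` to `1`. -/
def parallelPair (y z : Conductance R) : Circuit R 1 1 :=
  ⟨Bool, inferInstance, {Edge.resistor false true y, Edge.resistor false true z},
    fun _ => false, fun _ => true⟩

/-- A resistor from a junction to itself, as a circuit from `1` to `1`. -/
def shorted (y : Conductance R) : Circuit R 1 1 :=
  ⟨Unit, inferInstance, {Edge.resistor () () y}, fun _ => (), fun _ => ()⟩

theorem spiderSteps_parallelPair (y z : Conductance R) :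
    ReflTransGen Diagram.SpiderStep
      (Diagram.mk ((junction R 1 2).comp (((conductance y).tensor (conductance z)).comp
        (junction R 2 1))))
      (Diagram.mk (parallelPair y z)) := by
  have left (j : Fin 2) := Quot.sound (CompWire.left (A := junction R 1 2)
    (B := (conductance y).tensor (conductance z)) (D := junction R 2 1) j)
  have right (j : Fin 2) := Quot.sound (CompWire.right (A := junction R 1 2)
    (B := (conductance y).tensor (conductance z)) (D := junction R 2 1) j)
  refine spiderSteps_comp_comp (k := 2) (l := 2) _ _ _ _
    (π := Sum.elim (fun _ => false) (Sum.elim (Sum.elim _root_.id _root_.id) (fun _ => true)))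
    (.of_section (fun b : Bool => if b then Sum.inr (Sum.inr ()) else Sum.inl ()) ?_ ?_ ?_)
    ?_ (fun _ => rfl) (fun _ => rfl)
  · rintro (_ | _) <;> rfl
  · rintro _ _ (j | j) <;> fin_cases j <;> rfl
  · rintro (_ | ((_ | _) | (_ | _)) | _)
    exacts [rfl, left 0, (right 0).symm, left 1, (right 1).symm, rfl]
  · simp only [tensor, junction, conductance, parallelPair, Multiset.insert_eq_cons,
      Multiset.map_cons, Multiset.map_singleton, Multiset.map_zero, Multiset.singleton_add,
      Edge.map_resistor, Function.comp_apply, Sum.elim_inl, Sum.elim_inr, id_eq]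
    exact ((add_zero _).trans (zero_add _)).symm

theorem spiderSteps_shorted (y : Conductance R) :
    ReflTransGen Diagram.SpiderStep
      (Diagram.mk ((junction R 1 2).comp (((conductance y).tensor (id R 1)).comp
        (junction R 2 1))))
      (Diagram.mk (shorted y)) := by
  have left (j : Fin 2) := Quot.sound (CompWire.left (A := junction R 1 2)
    (B := (conductance y).tensor (id R 1)) (D := junction R 2 1) j)
  have right (j : Fin 2) := Quot.sound (CompWire.right (A := junction R 1 2)
    (B := (conductance y).tensor (id R 1)) (D := junction R 2 1) j)
  refine spiderSteps_comp_comp (k := 2) (l := 2) _ _ _ _ (π := fun _ => ())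
    (.of_section (fun _ => Sum.inl ()) (fun _ => rfl) (fun _ _ _ => rfl) ?_)
    ?_ (fun _ => rfl) (fun _ => rfl)
  · rintro (_ | ((_ | _) | x) | _)
    · rfl
    · exact left 0
    · exact (left 1).trans ((right 1).trans (right 0).symm)
    · obtain rfl : x = (0 : Fin 1) := Subsingleton.elim (α := Fin 1) _ _
      exact left 1
    · exact (left 1).trans (right 1)
  · simp only [tensor, id, junction, conductance, shorted, Multiset.map_singleton,
      Multiset.map_zero, Multiset.singleton_add, Multiset.cons_zero, Edge.map_resistor]
    exact ((add_zero _).trans (zero_add _)).symm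

theorem step_star [PositiveRig R] (y : Fin n → Conductance R) :
    (Diagram.mk (star y)).Step (Diagram.mk (mesh y)) := by
  refine ⟨_, _, ?_, ?_, .inr (.starMesh (Fin n) inferInstance n (fun i => i) y 0
    (fun i => i.elim0) fun i => i)⟩
  · rw [Multiset.map_zero, add_zero]
    exact Diagram.mk_eq_mk_iff.2
      ⟨Equiv.refl _, Edge.map_multiset_id _, fun i => i.elim0, fun _ => rfl⟩
  · rw [add_zero]
    rfl

end Circuit

namespace Diagram

variable {R : Type u} [Semifield R] {m n : ℕ}

theorem junction_one_one : junction R 1 1 = id R 1 :=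
  mk_eq_mk_iff.2 ⟨Equiv.ofUnique Unit (Fin 1), rfl, fun _ => Subsingleton.elim (α := Fin 1) _ _,
    fun _ => Subsingleton.elim (α := Fin 1) _ _⟩

variable [PositiveRig R]

theorem join_of_steps {c d : Diagram R m n} (h : ReflTransGen Step c d) :
    Join (ReflTransGen Step) c d :=
  ⟨d, h, .refl⟩

theorem join_of_equal {c d : Diagram R m n} (h : Equal c d) : Join (ReflTransGen Step) c d := by
  induction h with
  | refl c => exact (Relation.equivalence_join confluent_step).refl c
  | symm _ ih => exact (Relation.equivalence_join confluent_step).symm ih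
  | trans _ _ ih ih' => exact (Relation.equivalence_join confluent_step).trans ih ih'
  | comp_congr _ _ ih ih' =>
    obtain ⟨e, hc, hc'⟩ := ih
    obtain ⟨f, hd, hd'⟩ := ih'
    exact ⟨e.comp f, steps_comp hc hd, steps_comp hc' hd'⟩
  | tensor_congr _ _ ih ih' =>
    obtain ⟨e, hc, hc'⟩ := ih
    obtain ⟨f, hd, hd'⟩ := ih'
    exact ⟨e.tensor f, steps_tensor hc hd, steps_tensor hc' hd'⟩
  | id_comp c =>
    induction c using Quotient.inductionOn with
    | _ C => exact join_of_steps (steps_of_spiderSteps C.spiderSteps_id_comp)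
  | comp_id c =>
    induction c using Quotient.inductionOn with
    | _ C => exact join_of_steps (steps_of_spiderSteps C.spiderSteps_comp_id)
  | spider h => exact join_of_steps (.single ⟨_, _, rfl, rfl, .inl h⟩)
  | selfAdjoint y => exact join_of_steps (steps_of_spiderSteps (Circuit.spiderSteps_selfAdjoint y))
  | shortCircuit y =>
    have hstep : (mk (Circuit.shorted y)).Step (id R 1) := by
      rw [← junction_one_one]
      exact ⟨_, _, rfl, rfl,
        .inr (.shortCircuitLoop Unit inferInstance () y 0 (fun _ => ()) fun _ => ())⟩
    exact join_of_steps ((steps_of_spiderSteps (Circuit.spiderSteps_shorted y)).tail hstep)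
  | parallel y z =>
    exact join_of_steps ((steps_of_spiderSteps (Circuit.spiderSteps_parallelPair y z)).tail
      ⟨_, _, rfl, rfl, .inr (.parallel Bool inferInstance false true y z 0 (fun _ => false)
        fun _ => true)⟩)
  | starMesh y => exact join_of_steps (.single (Circuit.step_star y))

end Diagram

namespace Circuit

variable {R : Type u} [Semifield R] {m n m' n' : ℕ} (C : Circuit R m n) (D : Circuit R m' n')

theorem tensor_inp_castAdd (i : Fin m) :
    (C.tensor D).inp (Fin.castAdd m' i) = Sum.inl (C.inp i) := by
  simp only [tensor, Fin.append_left]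

theorem tensor_inp_natAdd (i : Fin m') : (C.tensor D).inp (Fin.natAdd m i) = Sum.inr (D.inp i) := by
  simp only [tensor, Fin.append_right]

theorem tensor_out_castAdd (j : Fin n) :
    (C.tensor D).out (Fin.castAdd n' j) = Sum.inl (C.out j) := by
  simp only [tensor, Fin.append_left]

theorem tensor_out_natAdd (j : Fin n') : (C.tensor D).out (Fin.natAdd n j) = Sum.inr (D.out j) := by
  simp only [tensor, Fin.append_right]

end Circuit

namespace Diagram

variable {R : Type u} [Semifield R] [PositiveRig R] {m n : ℕ}

theorem equal_of_spiderSteps {c d : Diagram R m n} (h : ReflTransGen SpiderStep c d) :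
    Equal c d := by
  induction h with
  | refl => exact .refl c
  | tail _ h ih =>
    obtain ⟨C, D, rfl, rfl, h⟩ := h
    exact ih.trans (.spider h)

end Diagram

namespace Context

variable {R : Type u} [Semifield R] {m n m' n' : ℕ}

/-- A list of the nodes of a context and the ends of its hole. -/
noncomputable def nth (K : Context R m n m' n') :
    Fin (Nat.card ((Fin m ⊕ Fin n) ⊕ K.Node)) ≃ (Fin m ⊕ Fin n) ⊕ K.Node :=
  have := K.finite_node
  (Finite.equivFin _).symm

/-- The part of a context before its hole, as a circuit: its outputs are the inputs of the hole,
followed by all nodes of the context and ends of the hole. -/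
noncomputable def before (K : Context R m n m' n') :
    Circuit R m' (m + Nat.card ((Fin m ⊕ Fin n) ⊕ K.Node)) where
  Node := (Fin m ⊕ Fin n) ⊕ K.Node
  finite_node := have := K.finite_node; inferInstance
  edges := K.edges
  inp := K.inp
  out := Fin.append (Sum.inl ∘ Sum.inl) K.nth

/-- The part of a context after its hole, with the same list of nodes and ends as inputs as the
part before the hole has as outputs.  The edges of the context are all in the part before. -/
noncomputable def after (K : Context R m n m' n') :
    Circuit R (n + Nat.card ((Fin m ⊕ Fin n) ⊕ K.Node)) n' where
  Node := (Fin m ⊕ Fin n) ⊕ K.Node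
  finite_node := have := K.finite_node; inferInstance
  edges := 0
  inp := Fin.append (Sum.inl ∘ Sum.inr) K.nth
  out := K.out

theorem before_out_castAdd (K : Context R m n m' n') (i : Fin m) :
    K.before.out (Fin.castAdd _ i) = Sum.inl (Sum.inl i) :=
  Fin.append_left (Sum.inl ∘ Sum.inl) _ i

theorem before_out_natAdd (K : Context R m n m' n')
    (i : Fin (Nat.card ((Fin m ⊕ Fin n) ⊕ K.Node))) :
    K.before.out (Fin.natAdd m i) = K.nth i :=
  Fin.append_right _ _ i

theorem after_inp_castAdd (K : Context R m n m' n') (j : Fin n) :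
    K.after.inp (Fin.castAdd _ j) = Sum.inl (Sum.inr j) :=
  Fin.append_left (Sum.inl ∘ Sum.inr) _ j

theorem after_inp_natAdd (K : Context R m n m' n')
    (i : Fin (Nat.card ((Fin m ⊕ Fin n) ⊕ K.Node))) :
    K.after.inp (Fin.natAdd n i) = K.nth i :=
  Fin.append_right _ _ i

/-- A context filled with `C` as a composite, in which identities beside `C` connect the nodes
before and after the hole. -/
noncomputable def composite (K : Context R m n m' n') (C : Circuit R m n) : Circuit R m' n' :=
  K.before.comp ((C.tensor (Circuit.id R (Nat.card ((Fin m ⊕ Fin n) ⊕ K.Node)))).comp K.after)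

/-- The pairs of nodes that are joined by the new wires of `K.composite C`. -/
abbrev CompositeWire (K : Context R m n m' n') (C : Circuit R m n) :=
  Circuit.CompWire K.before (C.tensor (Circuit.id R (Nat.card ((Fin m ⊕ Fin n) ⊕ K.Node)))) K.after

section

variable (K : Context R m n m' n') (C : Circuit R m n)

theorem compositeWire_inp (i : Fin m) :
    K.CompositeWire C (.inl (.inl (.inl i))) (.inr (.inl (.inl (C.inp i)))) := by
  have h : K.CompositeWire C _ _ := .left (Fin.castAdd _ i)
  rwa [Circuit.tensor_inp_castAdd, before_out_castAdd] at h

theorem compositeWire_out (j : Fin n) :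
    K.CompositeWire C (.inr (.inl (.inl (C.out j)))) (.inr (.inr (.inl (.inr j)))) := by
  have h : K.CompositeWire C _ _ := .right (Fin.castAdd _ j)
  rwa [Circuit.tensor_out_castAdd, after_inp_castAdd] at h

theorem compositeWire_left (i : Fin (Nat.card ((Fin m ⊕ Fin n) ⊕ K.Node))) :
    K.CompositeWire C (.inl (K.nth i)) (.inr (.inl (.inr i))) := by
  have h : K.CompositeWire C _ _ := .left (Fin.natAdd _ i)
  rwa [Circuit.tensor_inp_natAdd, before_out_natAdd] at h

theorem compositeWire_right (i : Fin (Nat.card ((Fin m ⊕ Fin n) ⊕ K.Node))) :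
    K.CompositeWire C (.inr (.inl (.inr i))) (.inr (.inr (K.nth i))) := by
  have h : K.CompositeWire C _ _ := .right (Fin.natAdd _ i)
  rwa [Circuit.tensor_out_natAdd, after_inp_natAdd] at h

theorem isQuotientBy_composite :
    IsQuotientBy (K.CompositeWire C)
      (Sum.elim (K.place C.inp C.out) (Sum.elim
        (Sum.elim Sum.inl (K.place C.inp C.out ∘ K.nth)) (K.place C.inp C.out))) := by
  have hV (v : (Fin m ⊕ Fin n) ⊕ K.Node) :
      Quot.mk (K.CompositeWire C) (.inl v) = Quot.mk _ (.inr (.inr v)) := by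
    obtain ⟨i, rfl⟩ := K.nth.surjective v
    exact (Quot.sound (K.compositeWire_left C i)).trans (Quot.sound (K.compositeWire_right C i))
  have hplace (v : (Fin m ⊕ Fin n) ⊕ K.Node) : Quot.mk (K.CompositeWire C)
      (Sum.elim (fun c => .inr (.inl (.inl c))) (fun x => .inl (.inr x)) (K.place C.inp C.out v)) =
        Quot.mk _ (.inl v) := by
    rcases v with (i | j) | x
    · exact (Quot.sound (K.compositeWire_inp C i)).symm
    · exact (Quot.sound (K.compositeWire_out C j)).trans (hV _).symm
    · rfl
  refine .of_section (Sum.elim (fun c => .inr (.inl (.inl c))) fun x => .inl (.inr x)) ?_ ?_ ?_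
  · rintro (c | x) <;> rfl
  · rintro _ _ (j | j) <;> induction j using Fin.addCases
    · rw [Circuit.tensor_inp_castAdd, before_out_castAdd]
      rfl
    · rw [Circuit.tensor_inp_natAdd, before_out_natAdd]
      rfl
    · rw [Circuit.tensor_out_castAdd, after_inp_castAdd]
      rfl
    · rw [Circuit.tensor_out_natAdd, after_inp_natAdd]
      rfl
  · rintro (v | (c | i) | v)
    · exact hplace v
    · rfl
    · exact (hplace _).trans (Quot.sound (K.compositeWire_left C i))
    · exact (hplace v).trans (hV v)

theorem spiderSteps_composite :
    ReflTransGen Diagram.SpiderStep (Diagram.mk (K.composite C)) (Diagram.mk (K.plug C)) := by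
  refine Circuit.spiderSteps_comp_comp _ _ _ _ (K.isQuotientBy_composite C) ?_ (fun _ => rfl)
    fun _ => rfl
  simp only [before, after, plug, Circuit.tensor, Circuit.id, Multiset.map_zero, add_zero,
    Edge.map_multiset_map]
  exact (add_comm _ _).trans (add_zero _).symm

end

theorem equal_plug [PositiveRig R] (K : Context R m n m' n') {C D : Circuit R m n}
    (h : Diagram.Equal (Diagram.mk C) (Diagram.mk D)) :
    Diagram.Equal (Diagram.mk (K.plug C)) (Diagram.mk (K.plug D)) := by
  have hcomposite : Diagram.Equal (Diagram.mk (K.composite C)) (Diagram.mk (K.composite D)) :=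
    .comp_congr (.refl (Diagram.mk K.before))
      (.comp_congr (.tensor_congr h (.refl (Diagram.id R _))) (.refl (Diagram.mk K.after)))
  exact ((Diagram.equal_of_spiderSteps (K.spiderSteps_composite C)).symm.trans hcomposite).trans
    (Diagram.equal_of_spiderSteps (K.spiderSteps_composite D))

end Context

namespace Circuit

variable {R : Type u} [Semifield R] {p q : ℕ}

theorem isExternal_of_bool (E : Multiset (Edge R Bool)) (s : Bool) :
    IsExternal (R := R) (m := 1) (n := 1)
      ⟨Bool, inferInstance, E, fun _ => false, fun _ => true⟩ s := by
  cases s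
  exacts [.inl ⟨0, rfl⟩, .inr ⟨0, rfl⟩]

/-- The pairs of nodes that are joined when the inputs of `S` are wired to `a` and its outputs
to `b`. -/
inductive AttachWire (S : Circuit R p q) {V : Type} (a : Fin p → V) (b : Fin q → V) :
    S.Node ⊕ V → S.Node ⊕ V → Prop where
  | inp (i : Fin p) : AttachWire S a b (.inl (S.inp i)) (.inr (a i))
  | out (j : Fin q) : AttachWire S a b (.inl (S.out j)) (.inr (b j))

end Circuit

namespace Context

variable {R : Type u} [Semifield R] {m n p q : ℕ}

/-- A circuit as a context, in which the ends of the hole are wired to the nodes `a i` and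
`b j`. -/
def attach {V : Type} (hV : Finite V) (E : Multiset (Edge R V)) (inp : Fin m → V)
    (out : Fin n → V) (a : Fin p → V) (b : Fin q → V) : Context R p q m n where
  Node := V
  finite_node := hV
  edges := E.map (Edge.map Sum.inr) +
    ((Finset.univ : Finset (Fin p)).val.map fun i => Edge.wire (.inl (.inl i)) (.inr (a i))) +
    (Finset.univ : Finset (Fin q)).val.map fun j => Edge.wire (.inl (.inr j)) (.inr (b j))
  inp := Sum.inr ∘ inp
  out := Sum.inr ∘ out

variable {V : Type} (hV : Finite V) (E : Multiset (Edge R V)) (inp : Fin m → V)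
    (out : Fin n → V) {a : Fin p → V} {b : Fin q → V}

theorem edges_plug_attach (S : Circuit R p q) :
    ((attach hV E inp out a b).plug S).edges =
      (((Finset.univ : Finset (Fin p)).val.map fun i => (Sum.inl (S.inp i), Sum.inr (a i))) +
          (Finset.univ : Finset (Fin q)).val.map fun j =>
            (Sum.inl (S.out j), Sum.inr (b j)) : Multiset ((S.Node ⊕ V) × (S.Node ⊕ V))).map
        (fun w => Edge.wire w.1 w.2) +
      (S.edges.map (Edge.map Sum.inl) + E.map (Edge.map Sum.inr)) := by
  simp only [plug, attach, Multiset.map_add, Multiset.map_map, Function.comp_def, Edge.map_map,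
    Edge.map_wire]
  exact (congrArg _ (add_assoc _ _ _)).trans ((add_assoc _ _ _).symm.trans (add_comm _ _))

theorem spiderSteps_plug_attach (S : Circuit R p q) (T : Circuit R m n) {π : S.Node ⊕ V → T.Node}
    (hπ : IsQuotientBy (S.AttachWire a b) π)
    (hedges : T.edges = S.edges.map (Edge.map (π ∘ Sum.inl)) + E.map (Edge.map (π ∘ Sum.inr)))
    (hinp : ∀ i, T.inp i = π (.inr (inp i))) (hout : ∀ j, T.out j = π (.inr (out j))) :
    ReflTransGen Diagram.SpiderStep (Diagram.mk ((attach hV E inp out a b).plug S))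
      (Diagram.mk T) := by
  have hmap : (S.edges.map (Edge.map Sum.inl) +
      E.map (Edge.map (Sum.inr : V → S.Node ⊕ V))).map (Edge.map π) = T.edges := by
    rw [Multiset.map_add, Edge.map_multiset_map, Edge.map_multiset_map, hedges]
  refine Circuit.spiderSteps_of_isQuotientBy _ (edges_plug_attach hV E inp out S)
    (hπ.congr (fun x y h => ?_) fun x y h => ?_) hmap.symm hinp hout
  · rcases Multiset.mem_add.1 h with h | h
    all_goals
      obtain ⟨j, -, hj⟩ := Multiset.mem_map.1 h
      obtain ⟨rfl, rfl⟩ := Prod.mk.inj hj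
    exacts [Quot.sound (.inp j), Quot.sound (.out j)]
  · cases h with
    | inp i =>
      exact Quot.sound (Multiset.mem_add.2 (.inl (Multiset.mem_map_of_mem _ (Finset.mem_univ i))))
    | out j =>
      exact Quot.sound (Multiset.mem_add.2 (.inr (Multiset.mem_map_of_mem _ (Finset.mem_univ j))))

theorem spiderSteps_plug_attach_of_isExternal (S : Circuit R p q) (hS : ∀ s, S.IsExternal s)
    (φ : S.Node → V) (ha : ∀ i, φ (S.inp i) = a i) (hb : ∀ j, φ (S.out j) = b j) :
    ReflTransGen Diagram.SpiderStep (Diagram.mk ((attach hV E inp out a b).plug S))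
      (Diagram.mk ⟨V, hV, S.edges.map (Edge.map φ) + E, inp, out⟩) := by
  refine spiderSteps_plug_attach hV E inp out S ⟨V, hV, S.edges.map (Edge.map φ) + E, inp, out⟩
    (π := Sum.elim φ id) (.of_section Sum.inr (fun _ => rfl) ?_ ?_)
    (congrArg (S.edges.map (Edge.map φ) + ·) (Edge.map_multiset_id E).symm) (fun _ => rfl)
    fun _ => rfl
  · rintro _ _ (i | j)
    exacts [ha i, hb j]
  · rintro (s | v)
    · rcases hS s with ⟨i, rfl⟩ | ⟨j, rfl⟩
      · exact (congrArg (Quot.mk _ ∘ Sum.inr) (ha i)).trans (Quot.sound (.inp i)).symm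
      · exact (congrArg (Quot.mk _ ∘ Sum.inr) (hb j)).trans (Quot.sound (.out j)).symm
    · rfl

theorem spiderSteps_plug_attach_star {k : ℕ} (a : Fin 0 → V) (b : Fin k → V)
    (y : Fin k → Conductance R) :
    ReflTransGen Diagram.SpiderStep (Diagram.mk ((attach hV E inp out a b).plug (Circuit.star y)))
      (Diagram.mk ⟨Option V, inferInstance,
          Circuit.starEdges none (some ∘ b) y + E.map (Edge.map some),
          some ∘ inp, some ∘ out⟩) := by
  refine spiderSteps_plug_attach hV E inp out (Circuit.star y) ⟨Option V, _, _, _, _⟩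
    (π := Sum.elim (Option.map b) some)
    (.of_section (fun t => t.elim (.inl none) .inr) ?_ ?_ ?_) ?_ (fun _ => rfl) fun _ => rfl
  · rintro (_ | v) <;> rfl
  · rintro _ _ (i | j)
    exacts [i.elim0, rfl]
  · rintro ((_ | j) | v)
    exacts [rfl, (Quot.sound (.out j)).symm, rfl]
  · simp only [Circuit.star, Multiset.map_map, Function.comp_def, Edge.map_resistor]
    rfl

end Context

namespace Diagram

variable {R : Type u} [Semifield R] [PositiveRig R] {m n p q : ℕ}

theorem equal_shorted (y : Conductance R) :
    Equal (mk (Circuit.shorted y)) (mk (Circuit.junction R 1 1)) := by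
  change Equal _ (junction R 1 1)
  rw [junction_one_one]
  exact (equal_of_spiderSteps (Circuit.spiderSteps_shorted y)).symm.trans (.shortCircuit y)

theorem equal_parallelPair (y z : Conductance R) :
    Equal (mk (Circuit.parallelPair y z)) (mk (Circuit.conductance (y.add z))) :=
  (equal_of_spiderSteps (Circuit.spiderSteps_parallelPair y z)).symm.trans (.parallel y z)

variable {V : Type} (hV : Finite V) (E : Multiset (Edge R V)) (inp : Fin m → V) (out : Fin n → V)

theorem equal_attach {S S' : Circuit R p q} (h : Equal (mk S) (mk S')) (a : Fin p → V)
    (b : Fin q → V) (hS : ∀ s, S.IsExternal s) (hS' : ∀ s, S'.IsExternal s) {φ : S.Node → V}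
    {φ' : S'.Node → V} (ha : ∀ i, φ (S.inp i) = a i) (hb : ∀ j, φ (S.out j) = b j)
    (ha' : ∀ i, φ' (S'.inp i) = a i) (hb' : ∀ j, φ' (S'.out j) = b j) :
    Equal (mk ⟨V, hV, S.edges.map (Edge.map φ) + E, inp, out⟩)
      (mk ⟨V, hV, S'.edges.map (Edge.map φ') + E, inp, out⟩) :=
  ((equal_of_spiderSteps (Context.spiderSteps_plug_attach_of_isExternal hV E inp out S hS φ ha
    hb)).symm.trans ((Context.attach hV E inp out a b).equal_plug h)).trans
      (equal_of_spiderSteps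
        (Context.spiderSteps_plug_attach_of_isExternal hV E inp out S' hS' φ' ha' hb'))

theorem equal_shortCircuitLoop (u : V) (y : Conductance R) :
    Equal (mk ⟨V, hV, Edge.resistor u u y ::ₘ E, inp, out⟩) (mk ⟨V, hV, E, inp, out⟩) := by
  have h := equal_attach hV E inp out (equal_shorted y) (fun _ => u) (fun _ => u)
    (fun _ => .inl ⟨0, rfl⟩) (fun _ => .inl ⟨0, rfl⟩) (φ := fun _ => u) (φ' := fun _ => u)
    (fun _ => rfl) (fun _ => rfl) (fun _ => rfl) fun _ => rfl
  simpa only [Circuit.shorted, Circuit.junction, Multiset.map_singleton, Edge.map_resistor,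
    Multiset.map_zero, Multiset.singleton_add, zero_add] using h

theorem equal_shortCircuit (u v : V) (y : Conductance R) :
    Equal (mk ⟨V, hV, Edge.resistor u v y ::ₘ Edge.wire u v ::ₘ E, inp, out⟩)
      (mk ⟨V, hV, Edge.wire u v ::ₘ E, inp, out⟩) := by
  by_cases hvu : v = u
  · subst hvu
    exact equal_shortCircuitLoop hV _ inp out v y
  · have hcollapse (E : Multiset (Edge R V)) := equal_of_spiderSteps
      (.single (Circuit.spiderStep_collapse hV hvu E inp out))
    have h := hcollapse (Edge.resistor u v y ::ₘ E)
    rw [Multiset.map_cons, Edge.map_resistor, collapse_self, collapse_of_ne hvu hvu] at h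
    rw [Multiset.cons_swap]
    exact (h.trans (equal_shortCircuitLoop _ _ _ _ _ y)).trans (hcollapse E).symm

theorem equal_parallel (u v : V) (y z : Conductance R) :
    Equal (mk ⟨V, hV, Edge.resistor u v y ::ₘ Edge.resistor u v z ::ₘ E, inp, out⟩)
      (mk ⟨V, hV, Edge.resistor u v (y.add z) ::ₘ E, inp, out⟩) := by
  have h := equal_attach hV E inp out (equal_parallelPair y z) (fun _ => u) (fun _ => v)
    (Circuit.isExternal_of_bool _) (Circuit.isExternal_of_bool _) (φ := fun s => cond s v u)
    (φ' := fun s => cond s v u) (fun _ => rfl) (fun _ => rfl) (fun _ => rfl) fun _ => rfl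
  simpa only [Circuit.parallelPair, Circuit.conductance, Multiset.insert_eq_cons,
    Multiset.map_cons, Multiset.map_singleton, Edge.map_resistor, Multiset.cons_add,
    Multiset.singleton_add, cond_false, cond_true] using h

theorem equal_starMesh {k : ℕ} (a : Fin k → V) (y : Fin k → Conductance R) :
    Equal (mk ⟨Option V, inferInstance,
          Circuit.starEdges none (some ∘ a) y + E.map (Edge.map some), some ∘ inp, some ∘ out⟩)
      (mk ⟨V, hV, Circuit.meshEdges a y + E, inp, out⟩) := by
  have hmesh := equal_of_spiderSteps (Context.spiderSteps_plug_attach_of_isExternal hV E inp out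
    (a := fun i => i.elim0) (Circuit.mesh y) (fun s => .inr ⟨s, rfl⟩) a (fun i => i.elim0)
    fun _ => rfl)
  simp only [Circuit.mesh, Circuit.meshEdges, Multiset.map_map, Function.comp_def,
    Edge.map_resistor] at hmesh
  exact ((equal_of_spiderSteps (Context.spiderSteps_plug_attach_star hV E inp out _ a y)).symm.trans
    (Context.equal_plug _ (.starMesh y))).trans hmesh

theorem equal_of_step {c d : Diagram R m n} (h : c.Step d) : Equal c d := by
  obtain ⟨C, D, rfl, rfl, h | h⟩ := h
  · exact .spider h
  · cases h with
    | shortCircuit V hV u v y E inp out => exact equal_shortCircuit hV E inp out u v y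
    | shortCircuitLoop V hV u y E inp out => exact equal_shortCircuitLoop hV E inp out u y
    | parallel V hV u v y z E inp out => exact equal_parallel hV E inp out u v y z
    | starMesh V hV k a y E inp out => exact equal_starMesh hV E inp out a y

theorem equal_of_steps {c d : Diagram R m n} (h : ReflTransGen Step c d) : Equal c d := by
  induction h with
  | refl => exact .refl c
  | tail _ h ih => exact ih.trans (equal_of_step h)

theorem equal_of_join {c d : Diagram R m n} (h : Join (ReflTransGen Step) c d) : Equal c d := by
  obtain ⟨e, hc, hd⟩ := h
  exact (equal_of_steps hc).trans (equal_of_steps hd).symm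

end Diagram

theorem Resist.ofDiagram_eq_iff {R : Type u} [Semifield R] [PositiveRig R] {m n : ℕ}
    {c d : Diagram R m n} : ofDiagram c = ofDiagram d ↔ Diagram.Equal c d :=
  ⟨fun h => Quotient.exact (s := setoid R m n) h, fun h => Quotient.sound (s := setoid R m n) h⟩

theorem mainTheorem1 {R : Type u} [Semifield R] [PositiveRig R] (m n : ℕ) :
    (∀ c d : Diagram R m n, c.Step d →
      toLex (d.numNodes, d.numParallel) < toLex (c.numNodes, c.numParallel)) ∧
    Rewriting.Terminating (Diagram.Step (R := R) (m := m) (n := n)) ∧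
    Rewriting.LocallyConfluent (Diagram.Step (R := R) (m := m) (n := n)) ∧
    Rewriting.Confluent (Diagram.Step (R := R) (m := m) (n := n)) ∧
    (∀ d : Diagram R m n, Rewriting.IsNormal Diagram.Step d ↔ d.IsMeshFamily) ∧
    (∀ d : Diagram R m n, ∃! e, Relation.ReflTransGen Diagram.Step d e ∧ e.IsMeshFamily) ∧
    (∀ c d : Diagram R m n, Resist.ofDiagram c = Resist.ofDiagram d ↔
      Relation.Join (Relation.ReflTransGen Diagram.Step) c d) := by
  refine ⟨fun c d h => h.toLex_lt, Diagram.terminating_step,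
    Diagram.confluent_step.locallyConfluent, Diagram.confluent_step, Diagram.isNormal_step_iff,
    fun d => ?_, fun c d => ?_⟩
  · simpa only [Diagram.isNormal_step_iff] using
      Diagram.confluent_step.existsUnique_isNormal Diagram.terminating_step d
  · rw [Resist.ofDiagram_eq_iff]
    exact ⟨Diagram.join_of_equal, Diagram.equal_of_join⟩
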